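/- A Markov logic network (MLN) is a finite family of weighted formulas $(w_i,f_i)$, $1\le i\le m$, where $w_i\in\mathbb{R}$ and $f_i$ is a formula built with connectives from atoms $p(t_1,\dots,t_k)$ over finitely many predicates, whose arguments are logical variables (no quantifiers, functions or constants). It is in the two-variable fragment if at most two distinct logical variables occur in each $f_i$. For a finite domain $\mathbf{D}$ of constants, a possible world $\omega$ assigns a truth value to every ground atom; its weight is the product of $\exp(w_i)$ over all $i$ and all instantiations, by constants, of the variables occurring in $f_i$ for which the resulting ground formula is true in $\omega$, and $\Pr(\omega)$ is its weight divided by the sum of the weights of all worlds. We call a ground atom unary if it has at most one distinct argument, and binary otherwise. Theorem. Fix the formulas $f_1,\dots,f_m$ of an MLN in the two-variable fragment and a bound $b\in\mathbb{N}$. Then there are an algorithm for marginal inference and an algorithm for MPE inference, and for each of them a polynomial $\pi$, such that for all real weights $w_1,\dots,w_m$, every finite domain $\mathbf{D}$, every list $V$ of distinct ground atoms over $\mathbf{D}$ that consists of arbitrarily many unary atoms and at most $b$ binary atoms, and every assignment $\mathbf{e}$ of truth values to a subset $\mathbf{E}\subseteq V$, the algorithm halts on this input after at most $\pi(|\mathbf{D}|)$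 steps, with the following result: 1. (marginal inference) the probability $\Pr(\mathbf{e})$; 2. (MPE inference over $V$) an assignment $\mathbf{y}$ to the atoms in $V\setminus\mathbf{E}$ that maximises $\Pr(\mathbf{y},\mathbf{e})=\sum_{\mathbf{z}}\Pr(\mathbf{y},\mathbf{e},\mathbf{z})$, where $\mathbf{z}$ ranges over the assignments to the ground atoms outside $V$. That is, MPE and marginal inference over the unary atoms and a bounded number of binary atoms is domain-lifted: it takes time polynomial in the size of the domain. Algorithms are programs for a random access machine with real arithmetic: a program manipulates natural numbers (addition, truncated subtraction, comparison, indexing of arrays) and exact real numbers (field operations and comparison, rational constants), each operation costs one step, and the input consists of $|\mathbf{D}|$, $V$, $\mathbf{e}$ and the real numbers $\exp(w_1),\dots,\exp(w_m)$. -/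

import Mathlib

open scoped BigOperators

namespace MarkovLogic

/-! ### Markov logic networks

A signature is a finite family of predicates `p : Fin r` with arities `ar p`. -/

/-- Atoms `p(t₁, …, t_k)`, `k = ar p`, whose arguments are taken from `T`. -/
abbrev Atom {r : ℕ} (ar : Fin r → ℕ) (T : Type) : Type :=
  Σ p : Fin r, (Fin (ar p) → T)

/-- Ground atoms over the domain of constants `{0, …, n - 1}`. -/
abbrev GroundAtom {r : ℕ} (ar : Fin r → ℕ) (n : ℕ) : Type :=
  Atom ar (Fin n)

/-- The number of distinct arguments of an atom: `P(a)` and `Q(a, a)` have one, `Q(a, b)` with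
`a ≠ b` has two. -/
def Atom.width {r : ℕ} {ar : Fin r → ℕ} {T : Type} [DecidableEq T] (a : Atom ar T) : ℕ :=
  (Finset.univ.image a.2).card

/-- Function-free and constant-free formulas: atoms over logical variables (named by natural
numbers), combined with connectives. -/
inductive Formula {r : ℕ} (ar : Fin r → ℕ) : Type
  | atom (a : Atom ar ℕ)
  | neg (f : Formula ar)
  | and (f g : Formula ar)
  | or (f g : Formula ar)
  | imp (f g : Formula ar)
  | iff (f g : Formula ar)

namespace Formula

variable {r : ℕ} {ar : Fin r → ℕ}

/-- The logical variables that occur in a formula. -/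
def vars : Formula ar → Finset ℕ
  | atom a => Finset.univ.image a.2
  | neg f => f.vars
  | and f g => f.vars ∪ g.vars
  | or f g => f.vars ∪ g.vars
  | imp f g => f.vars ∪ g.vars
  | iff f g => f.vars ∪ g.vars

/-- Truth value, in the possible world `ω`, of the grounding of a formula that instantiates its
logical variables by `σ`. -/
def eval {n : ℕ} (ω : GroundAtom ar n → Bool) : (f : Formula ar) → (f.vars → Fin n) → Bool
  | atom a, σ => ω ⟨a.1, fun i => σ ⟨a.2 i, Finset.mem_image_of_mem _ (Finset.mem_univ i)⟩⟩
  | neg f, σ => !(eval ω f σ)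
  | and f g, σ => eval ω f (fun x => σ ⟨x, Finset.mem_union_left _ x.2⟩) &&
      eval ω g (fun x => σ ⟨x, Finset.mem_union_right _ x.2⟩)
  | or f g, σ => eval ω f (fun x => σ ⟨x, Finset.mem_union_left _ x.2⟩) ||
      eval ω g (fun x => σ ⟨x, Finset.mem_union_right _ x.2⟩)
  | imp f g, σ => !(eval ω f (fun x => σ ⟨x, Finset.mem_union_left _ x.2⟩)) ||
      eval ω g (fun x => σ ⟨x, Finset.mem_union_right _ x.2⟩)
  | iff f g, σ => eval ω f (fun x => σ ⟨x, Finset.mem_union_left _ x.2⟩) ==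
      eval ω g (fun x => σ ⟨x, Finset.mem_union_right _ x.2⟩)

end Formula

noncomputable section

/-- The weight of a possible world under the MLN `{(w i, F i)}`: the product of `exp (w i)` over
all groundings of the formulas `F i` that the world satisfies. -/
def worldWeight {r m n : ℕ} {ar : Fin r → ℕ} (F : Fin m → Formula ar) (w : Fin m → ℝ)
    (ω : GroundAtom ar n → Bool) : ℝ :=
  ∏ i, ∏ σ : (F i).vars → Fin n, if (F i).eval ω σ then Real.exp (w i) else 1

/-- The assignment `y` is compatible with the partial assignment `e`. -/
def Agrees {q : ℕ} (y : Fin q → Bool) (e : Fin q → Option Bool) : Prop :=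
  ∀ i, ∀ v ∈ e i, y i = v

open Classical in
/-- `Pr(e)`, for a partial assignment `e` to the ground atoms `V 0, …, V (q - 1)`; the atom `V i`
is left unassigned when `e i = none`. -/
def prob {r m n q : ℕ} {ar : Fin r → ℕ} (F : Fin m → Formula ar) (w : Fin m → ℝ)
    (V : Fin q → GroundAtom ar n) (e : Fin q → Option Bool) : ℝ :=
  (∑ ω : GroundAtom ar n → Bool with Agrees (fun i => ω (V i)) e, worldWeight F w ω) /
    ∑ ω : GroundAtom ar n → Bool, worldWeight F w ω

/-- `y` maximises `Pr(V = y)` among the assignments to `V` that are compatible with the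
evidence `e`; atoms outside `V` are summed out. -/
def IsMPE {r m n q : ℕ} {ar : Fin r → ℕ} (F : Fin m → Formula ar) (w : Fin m → ℝ)
    (V : Fin q → GroundAtom ar n) (e : Fin q → Option Bool) (y : Fin q → Bool) : Prop :=
  Agrees y e ∧ ∀ y' : Fin q → Bool, Agrees y' e →
    prob F w V (fun i => some (y' i)) ≤ prob F w V (fun i => some (y i))

/-! ### A real random access machine with unit costs

Programs are while-programs over arrays of natural numbers (with addition and truncated
subtraction, for counting and addressing) and arrays of real numbers (with the field operations
and order tests, but without rounding). A program mentions finitely many arrays, by their numbers.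
Every operation, array access, assignment and test costs one step. -/

/-- The memory: the contents `nat k i` and `real k i` of cell `i` of the `k`-th array. -/
structure State : Type where
  nat : ℕ → ℕ → ℕ
  real : ℕ → ℕ → ℝ

/-- Expressions with natural number values. -/
inductive NatExp : Type
  | const (c : ℕ)
  | get (k : ℕ) (i : NatExp)
  | add (a b : NatExp)
  | sub (a b : NatExp)

namespace NatExp

def eval (s : State) : NatExp → ℕ
  | const c => c
  | get k i => s.nat k (i.eval s)
  | add a b => a.eval s + b.eval s
  | sub a b => a.eval s - b.eval s

def cost : NatExp → ℕ
  | const _ => 1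
  | get _ i => i.cost + 1
  | add a b => a.cost + b.cost + 1
  | sub a b => a.cost + b.cost + 1

end NatExp

/-- Expressions with real values. The only constants are rational numbers. -/
inductive RealExp : Type
  | const (c : ℚ)
  | get (k : ℕ) (i : NatExp)
  | add (a b : RealExp)
  | sub (a b : RealExp)
  | mul (a b : RealExp)
  | div (a b : RealExp)

namespace RealExp

def eval (s : State) : RealExp → ℝ
  | const c => (c : ℝ)
  | get k i => s.real k (i.eval s)
  | add a b => a.eval s + b.eval s
  | sub a b => a.eval s - b.eval s
  | mul a b => a.eval s * b.eval s
  | div a b => a.eval s / b.eval s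

def cost : RealExp → ℕ
  | const _ => 1
  | get _ i => i.cost + 1
  | add a b => a.cost + b.cost + 1
  | sub a b => a.cost + b.cost + 1
  | mul a b => a.cost + b.cost + 1
  | div a b => a.cost + b.cost + 1

end RealExp

/-- Tests. -/
inductive Test : Type
  | natLt (a b : NatExp)
  | realLt (a b : RealExp)
  | not (t : Test)
  | and (t u : Test)

namespace Test

def eval (s : State) : Test → Prop
  | natLt a b => a.eval s < b.eval s
  | realLt a b => a.eval s < b.eval s
  | not t => ¬ t.eval s
  | and t u => t.eval s ∧ u.eval s

def cost : Test → ℕ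
  | natLt a b => a.cost + b.cost + 1
  | realLt a b => a.cost + b.cost + 1
  | not t => t.cost + 1
  | and t u => t.cost + u.cost + 1

end Test

/-- Programs. `setNat k i a` is the assignment of `a` to cell `i` of the `k`-th array of natural
numbers, and `setReal` does the same for the arrays of reals. -/
inductive Program : Type
  | skip
  | setNat (k : ℕ) (i a : NatExp)
  | setReal (k : ℕ) (i : NatExp) (a : RealExp)
  | seq (P Q : Program)
  | ite (t : Test) (P Q : Program)
  | while (t : Test) (P : Program)

def State.updNat (s : State) (k i v : ℕ) : State :=
  { s with nat := Function.update s.nat k (Function.update (s.nat k) i v) }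

def State.updReal (s : State) (k i : ℕ) (v : ℝ) : State :=
  { s with real := Function.update s.real k (Function.update (s.real k) i v) }

/-- `Runs P s N s'`: started in `s`, the program `P` halts in `s'` after exactly `N` steps. -/
inductive Runs : Program → State → ℕ → State → Prop
  | skip (s : State) : Runs .skip s 1 s
  | setNat (k : ℕ) (i a : NatExp) (s : State) :
      Runs (.setNat k i a) s (i.cost + a.cost + 1) (s.updNat k (i.eval s) (a.eval s))
  | setReal (k : ℕ) (i : NatExp) (a : RealExp) (s : State) :
      Runs (.setReal k i a) s (i.cost + a.cost + 1) (s.updReal k (i.eval s) (a.eval s))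
  | seq {P Q : Program} {s s' s'' : State} {M N : ℕ} (hP : Runs P s M s') (hQ : Runs Q s' N s'') :
      Runs (.seq P Q) s (M + N) s''
  | iteTrue {t : Test} {P Q : Program} {s s' : State} {N : ℕ} (ht : t.eval s)
      (hP : Runs P s N s') : Runs (.ite t P Q) s (t.cost + N) s'
  | iteFalse {t : Test} {P Q : Program} {s s' : State} {N : ℕ} (ht : ¬ t.eval s)
      (hQ : Runs Q s N s') : Runs (.ite t P Q) s (t.cost + N) s'
  | whileTrue {t : Test} {P : Program} {s s' s'' : State} {M N : ℕ} (ht : t.eval s)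
      (hP : Runs P s M s') (hW : Runs (.while t P) s' N s'') :
      Runs (.while t P) s (t.cost + M + N) s''
  | whileFalse {t : Test} {P : Program} {s : State} (ht : ¬ t.eval s) :
      Runs (.while t P) s t.cost s

/-! ### Presentation of an inference problem to the machine -/

/-- `0` and `1` for the truth values, `2` for an unassigned atom. -/
def encodeEvidence : Option Bool → ℕ
  | some false => 0
  | some true => 1
  | none => 2

/-- The initial memory, zero except for the following cells.
Arrays of naturals: array `0` holds the domain size `n` and the number `q` of listed atoms; cell
`i < q` of array `1`, `2`, `4 + j` holds the predicate of the atom `V i`, its value in `e`, and its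
`j`-th argument. (Array `3` is reserved for output.)
Arrays of reals: cell `i < m` of array `0` holds `exp (w i)`. (Array `1` is reserved for output.) -/
def inputState {r m n q : ℕ} {ar : Fin r → ℕ} (w : Fin m → ℝ) (V : Fin q → GroundAtom ar n)
    (e : Fin q → Option Bool) : State where
  nat k i :=
    match k with
    | 0 => if i = 0 then n else if i = 1 then q else 0
    | 1 => if h : i < q then ((V ⟨i, h⟩).1 : ℕ) else 0
    | 2 => if h : i < q then encodeEvidence (e ⟨i, h⟩) else 0
    | 3 => 0
    | j + 4 =>
      if h : i < q then
        if h' : j < ar (V ⟨i, h⟩).1 then ((V ⟨i, h⟩).2 ⟨j, h'⟩ : ℕ) else 0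
      else 0
  real k i := if h : k = 0 ∧ i < m then Real.exp (w ⟨i, h.2⟩) else 0

end

end MarkovLogic

/-! With at most two variables, every grounding of a formula uses at most two constants. The weight
of a world is therefore a product of a factor for the atoms without arguments, a factor for each
constant `c` and a factor for each pair `c < d` (`worldWeight_eq`). Fix the values of the atoms
without arguments. The factor of `c` depends only on the truth table of the atoms over `c` alone,
its type; the factor of a pair depends on the two types and on the table of the atoms over that
pair, which can be summed out pair by pair (`sum_worldWeight`). What remains is a sum over sequences
of types. If the pair weights depend only on the types, then the contribution of the next constant
depends only on how often each type was used before, so dynamic programming over polynomially many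
count vectors evaluates the sum (`sum_seqWeight`, `RComp.restWeight`).

Evidence on unary atoms changes the weights of single positions. Evidence on binary atoms makes pair
weights depend on the constants, but only on those in the at most `b` wide listed atoms. Such
constants are named by a bounded set of slots, and the slot is made part of the type
(`Encodes.restWeight_eq`). Atoms with three or more distinct arguments influence no weight and are
independent fair coins. This gives marginal inference (`Encodes.liftedProb_eq`).

For MPE, a permutation of the constants that preserves slots and evidence preserves probabilities
(`prob_le_of_perm`). Hence in each class of interchangeable constants those with a given table of
listed unary atoms may be assumed to form an interval. Boundedly many interval ends and truth values
describe such an assignment, so polynomially many candidates suffice (`Encodes.exists_cand`), and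
marginal inference compares them.

On the machine side, `NComp`, `RComp` and `TComp` demand, for every sufficiently high level `L`, a
polynomial-time program that delivers its result in array `L` and changes no array below. Closure
under arithmetic, case distinctions, bounded sums and products and tabulated recursion lets the
formulas be compiled along their syntax. -/

namespace MarkovLogic

noncomputable section

/-! ### Programs with polynomial running time -/

/-- The two memories coincide on the arrays with numbers below `L`. -/
def AgreeBelow (L : ℕ) (s s' : State) : Prop :=
  ∀ k < L, s'.nat k = s.nat k ∧ s'.real k = s.real k

theorem AgreeBelow.refl (L : ℕ) (s : State) : AgreeBelow L s s := fun _ _ => ⟨rfl, rfl⟩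

theorem AgreeBelow.trans {L : ℕ} {s s' s'' : State} (h : AgreeBelow L s s')
    (h' : AgreeBelow L s' s'') : AgreeBelow L s s'' := fun k hk =>
  ⟨(h' k hk).1.trans (h k hk).1, (h' k hk).2.trans (h k hk).2⟩

theorem AgreeBelow.mono {L L' : ℕ} {s s' : State} (h : AgreeBelow L' s s') (hL : L ≤ L') :
    AgreeBelow L s s' := fun k hk => h k (hk.trans_le hL)

theorem State.updNat_nat (s : State) (k i v k' i' : ℕ) :
    (s.updNat k i v).nat k' i' = if k' = k ∧ i' = i then v else s.nat k' i' := by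
  unfold State.updNat
  by_cases h : k' = k
  · subst h
    by_cases h' : i' = i <;> simp [h']
  · simp [h]

theorem State.updReal_nat (s : State) (k i : ℕ) (v : ℝ) : (s.updReal k i v).nat = s.nat := rfl

theorem State.updReal_real (s : State) (k i : ℕ) (v : ℝ) (k' i' : ℕ) :
    (s.updReal k i v).real k' i' = if k' = k ∧ i' = i then v else s.real k' i' := by
  unfold State.updReal
  by_cases h : k' = k
  · subst h
    by_cases h' : i' = i <;> simp [h']
  · simp [h]

theorem agreeBelow_updNat {L k : ℕ} (hk : L ≤ k) (s : State) (i v : ℕ) :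
    AgreeBelow L s (s.updNat k i v) := fun k' hk' => by
  refine ⟨?_, rfl⟩
  funext i'
  rw [State.updNat_nat, if_neg (by omega)]

theorem agreeBelow_updReal {L k : ℕ} (hk : L ≤ k) (s : State) (i : ℕ) (v : ℝ) :
    AgreeBelow L s (s.updReal k i v) := fun k' hk' => by
  refine ⟨rfl, ?_⟩
  funext i'
  rw [State.updReal_real, if_neg (by omega)]

/-- A property of memories that depends only on the arrays with numbers below `L`. -/
def Stable (L : ℕ) (Q : State → Prop) : Prop :=
  ∀ s s', AgreeBelow L s s' → Q s → Q s'

theorem Stable.mono {L L' : ℕ} {Q : State → Prop} (h : Stable L Q) (hL : L ≤ L') : Stable L' Q :=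
  fun s s' hs => h s s' (hs.mono hL)

theorem Stable.and {L : ℕ} {Q R : State → Prop} (hQ : Stable L Q) (hR : Stable L R) :
    Stable L (fun s => Q s ∧ R s) := fun s s' hs h => ⟨hQ s s' hs h.1, hR s s' hs h.2⟩

theorem Stable.const (L : ℕ) (Q : Prop) : Stable L (fun _ => Q) := fun _ _ _ h => h

theorem Stable.nat_eq {L k : ℕ} (hk : k < L) (i v : ℕ) : Stable L (fun s => s.nat k i = v) :=
  fun _ _ hs h => (congrFun (hs k hk).1 i).trans h

theorem Stable.real_eq {L k : ℕ} (hk : k < L) (i : ℕ) (v : ℝ) :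
    Stable L (fun s => s.real k i = v) :=
  fun _ _ hs h => (congrFun (hs k hk).2 i).trans h

theorem Stable.forall_real_eq {L k : ℕ} (hk : k < L) (M : ℕ) (a : ℕ → ℝ) :
    Stable L (fun s => ∀ i < M, s.real k i = a i) :=
  fun s s' hs h i hi => by rw [(hs k hk).2, h i hi]

/-- Some program leads from every memory described by `pre x` to one described by `post x`, leaves
the arrays below `L` unchanged, and runs for a number of steps that is polynomial in `sz x`. -/
def Does {X : Type} (pre : X → State → Prop) (sz : X → ℕ) (L : ℕ) (post : X → State → Prop) :
    Prop :=
  ∃ (P : Program) (p : Polynomial ℕ), ∀ x s, pre x s →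
    ∃ N s', Runs P s N s' ∧ N ≤ p.eval (sz x) ∧ AgreeBelow L s s' ∧ post x s'

namespace Does

variable {X : Type} {pre mid post : X → State → Prop} {sz : X → ℕ} {L : ℕ}

theorem seq (h₁ : Does pre sz L mid) (h₂ : Does mid sz L post) : Does pre sz L post := by
  obtain ⟨P, p, hP⟩ := h₁
  obtain ⟨Q, q, hQ⟩ := h₂
  refine ⟨.seq P Q, p + q, fun x s hs => ?_⟩
  obtain ⟨N, s', h1, h2, h3, h4⟩ := hP x s hs
  obtain ⟨M, s'', k1, k2, k3, k4⟩ := hQ x s' h4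
  exact ⟨N + M, s'', .seq h1 k1, by rw [Polynomial.eval_add]; omega, h3.trans k3, k4⟩

theorem conseq {L' : ℕ} {pre' post' : X → State → Prop} (h : Does pre' sz L' post')
    (hL : L ≤ L') (hpre : ∀ x s, pre x s → pre' x s)
    (hpost : ∀ x s s', pre x s → AgreeBelow L' s s' → post' x s' → post x s') :
    Does pre sz L post := by
  obtain ⟨P, p, hP⟩ := h
  refine ⟨P, p, fun x s hs => ?_⟩
  obtain ⟨N, s', h1, h2, h3, h4⟩ := hP x s (hpre x s hs)
  exact ⟨N, s', h1, h2, h3.mono hL, hpost x s s' hs h3 h4⟩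

theorem setNat {k : ℕ} (hk : L ≤ k) (i a : NatExp)
    (h : ∀ x s, pre x s → post x (s.updNat k (i.eval s) (a.eval s))) : Does pre sz L post :=
  ⟨.setNat k i a, Polynomial.C (i.cost + a.cost + 1), fun x s hs =>
    ⟨_, _, .setNat k i a s, by simp, agreeBelow_updNat hk s _ _, h x s hs⟩⟩

theorem setReal {k : ℕ} (hk : L ≤ k) (i : NatExp) (a : RealExp)
    (h : ∀ x s, pre x s → post x (s.updReal k (i.eval s) (a.eval s))) : Does pre sz L post :=
  ⟨.setReal k i a, Polynomial.C (i.cost + a.cost + 1), fun x s hs =>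
    ⟨_, _, .setReal k i a s, by simp, agreeBelow_updReal hk s _ _, h x s hs⟩⟩

theorem ite (t : Test) (h₁ : Does (fun x s => pre x s ∧ t.eval s) sz L post)
    (h₂ : Does (fun x s => pre x s ∧ ¬ t.eval s) sz L post) : Does pre sz L post := by
  obtain ⟨P, p, hP⟩ := h₁
  obtain ⟨Q, q, hQ⟩ := h₂
  refine ⟨.ite t P Q, Polynomial.C t.cost + p + q, fun x s hs => ?_⟩
  by_cases ht : t.eval s
  · obtain ⟨N, s', h1, h2, h3⟩ := hP x s ⟨hs, ht⟩
    exact ⟨_, s', .iteTrue ht h1, by simp only [Polynomial.eval_add, Polynomial.eval_C]; omega, h3⟩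
  · obtain ⟨N, s', h1, h2, h3⟩ := hQ x s ⟨hs, ht⟩
    exact ⟨_, s', .iteFalse ht h1, by simp only [Polynomial.eval_add, Polynomial.eval_C]; omega, h3⟩

/-- A loop whose counter is `nat I 0`, which the body increases, and whose bound is `nat J 0`. -/
theorem whileLt {I J : ℕ} {inv : X → ℕ → State → Prop} {b : X → ℕ}
    (hcell : ∀ x i s, inv x i s → s.nat I 0 = i ∧ s.nat J 0 = b x)
    (hb : ∃ p : Polynomial ℕ, ∀ x s, inv x 0 s → b x ≤ p.eval (sz x))
    (hbody : Does (fun (z : X × ℕ) s => inv z.1 z.2 s ∧ z.2 < b z.1) (fun z => sz z.1) L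
      (fun z s => inv z.1 (z.2 + 1) s)) :
    Does (fun x s => inv x 0 s) sz L (fun x s => inv x (b x) s) := by
  obtain ⟨P, p, hP⟩ := hbody
  obtain ⟨q, hq⟩ := hb
  set t : Test := .natLt (.get I (.const 0)) (.get J (.const 0)) with ht
  -- Induction on the number `d` of remaining iterations. The bound on the cost of the body does not
  -- depend on the counter, so the total is linear in `d`.
  have key : ∀ x d i s, inv x i s → i + d = b x →
      ∃ N s', Runs (.while t P) s N s' ∧ N ≤ d * (t.cost + p.eval (sz x)) + t.cost ∧
        AgreeBelow L s s' ∧ inv x (b x) s' := by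
    intro x d
    induction d with
    | zero =>
      intro i s hs hi
      obtain ⟨h1, h2⟩ := hcell x i s hs
      refine ⟨_, s, .whileFalse ?_, by simp, .refl L s, ?_⟩
      · simp only [ht, Test.eval, NatExp.eval, h1, h2]; omega
      · have : i = b x := by omega
        exact this ▸ hs
    | succ d ih =>
      intro i s hs hi
      obtain ⟨h1, h2⟩ := hcell x i s hs
      obtain ⟨N, s', k1, k2, k3, k4⟩ := hP (x, i) s ⟨hs, by simp only; omega⟩
      obtain ⟨M, s'', l1, l2, l3, l4⟩ := ih (i + 1) s' k4 (by omega)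
      refine ⟨_, s'', .whileTrue ?_ k1 l1, ?_, k3.trans l3, l4⟩
      · simp only [ht, Test.eval, NatExp.eval, h1, h2]; omega
      · simp only at k2
        rw [Nat.succ_mul]; omega
  refine ⟨.while t P, q * (Polynomial.C t.cost + p) + Polynomial.C t.cost, fun x s hs => ?_⟩
  obtain ⟨N, s', h1, h2, h3, h4⟩ := key x (b x) 0 s hs (by omega)
  refine ⟨N, s', h1, h2.trans ?_, h3, h4⟩
  simp only [Polynomial.eval_add, Polynomial.eval_mul, Polynomial.eval_C]
  gcongr
  exact hq x s hs

end Does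

/-! ### Functions computable in polynomial time -/

/-- A representation of the elements of `X` by memories: a property of the arrays below `level`.
Running times are measured against `size`. -/
structure Ctx (X : Type) where
  rep : X → State → Prop
  size : X → ℕ
  level : ℕ
  stable : ∀ x, Stable level (rep x)

variable {X Y Z : Type}

/-- The context `E` extends `C`: a memory that represents `y` also represents `π y`. -/
structure Ext (E : Ctx Y) (C : Ctx X) (π : Y → X) : Prop where
  rep : ∀ y s, E.rep y s → C.rep (π y) s
  size : ∀ y, C.size (π y) = E.size y
  level : C.level ≤ E.level

theorem Ext.refl (C : Ctx X) : Ext C C (fun x => x) := ⟨fun _ _ h => h, fun _ => rfl, le_rfl⟩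

theorem Ext.trans {E' : Ctx Z} {E : Ctx Y} {C : Ctx X} {π' : Z → Y} {π : Y → X}
    (h' : Ext E' E π') (h : Ext E C π) : Ext E' C (fun z => π (π' z)) :=
  ⟨fun z s hs => h.rep _ _ (h'.rep z s hs), fun z => (h.size _).trans (h'.size z),
    h.level.trans h'.level⟩

/-- `f` is polynomially bounded and computable in polynomial time. -/
def NComp (C : Ctx X) (f : X → ℕ) : Prop :=
  (∃ p : Polynomial ℕ, ∀ x s, C.rep x s → f x ≤ p.eval (C.size x)) ∧
    ∀ L, C.level ≤ L → Does C.rep C.size L (fun x s => s.nat L 0 = f x)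

/-- The real function `f` is computable in polynomial time. -/
def RComp (C : Ctx X) (f : X → ℝ) : Prop :=
  ∀ L, C.level ≤ L → Does C.rep C.size L (fun x s => s.real L 0 = f x)

open Classical in
/-- The predicate `p` is decidable in polynomial time. -/
def TComp (C : Ctx X) (p : X → Prop) : Prop :=
  NComp C (fun x => if p x then 1 else 0)

/-- Computability of a function of `x` and of a computable natural number. -/
def NFun (C : Ctx X) (f : X → ℕ → ℕ) : Prop :=
  ∀ (Y : Type) (E : Ctx Y) (π : Y → X), Ext E C π → ∀ v : Y → ℕ, NComp E v →
    NComp E (fun y => f (π y) (v y))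

/-- Quantifying over all extensions `E` of `C` makes the function usable in loop bodies and beside
tables, whose memories hold further data. -/
def RFun (C : Ctx X) (f : X → ℕ → ℝ) : Prop :=
  ∀ (Y : Type) (E : Ctx Y) (π : Y → X), Ext E C π → ∀ v : Y → ℕ, NComp E v →
    RComp E (fun y => f (π y) (v y))

def TFun (C : Ctx X) (p : X → ℕ → Prop) : Prop :=
  ∀ (Y : Type) (E : Ctx Y) (π : Y → X), Ext E C π → ∀ v : Y → ℕ, NComp E v →
    TComp E (fun y => p (π y) (v y))

theorem Does.reindex {pre post : X → State → Prop} {sz : X → ℕ} {L : ℕ}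
    (h : Does pre sz L post) (π : Y → X) :
    Does (fun y => pre (π y)) (fun y => sz (π y)) L (fun y => post (π y)) := by
  obtain ⟨P, p, hP⟩ := h
  exact ⟨P, p, fun y s hs => hP (π y) s hs⟩

theorem NComp.ext {E : Ctx Y} {C : Ctx X} {π : Y → X} {f : X → ℕ} (hf : NComp C f)
    (h : Ext E C π) : NComp E (fun y => f (π y)) := by
  refine ⟨?_, fun L hL => ?_⟩
  · obtain ⟨p, hp⟩ := hf.1
    exact ⟨p, fun y s hs => (hp _ s (h.rep y s hs)).trans_eq (by rw [h.size])⟩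
  · have := (hf.2 L (h.level.trans hL)).reindex π
    simp only [h.size] at this
    exact this.conseq le_rfl h.rep (fun _ _ _ _ _ h => h)

theorem RComp.ext {E : Ctx Y} {C : Ctx X} {π : Y → X} {f : X → ℝ} (hf : RComp C f)
    (h : Ext E C π) : RComp E (fun y => f (π y)) := fun L hL => by
  have := (hf L (h.level.trans hL)).reindex π
  simp only [h.size] at this
  exact this.conseq le_rfl h.rep (fun _ _ _ _ _ h => h)

theorem NFun.ext {E : Ctx Y} {C : Ctx X} {π : Y → X} {f : X → ℕ → ℕ} (hf : NFun C f)
    (h : Ext E C π) : NFun E (fun y => f (π y)) :=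
  fun _ E' _ h' v hv => hf _ E' _ (h'.trans h) v hv

theorem RFun.ext {E : Ctx Y} {C : Ctx X} {π : Y → X} {f : X → ℕ → ℝ} (hf : RFun C f)
    (h : Ext E C π) : RFun E (fun y => f (π y)) :=
  fun _ E' _ h' v hv => hf _ E' _ (h'.trans h) v hv

theorem NFun.app {C : Ctx X} {f : X → ℕ → ℕ} (hf : NFun C f) {v : X → ℕ} (hv : NComp C v) :
    NComp C (fun x => f x (v x)) := hf X C _ (.refl C) v hv

theorem RFun.app {C : Ctx X} {f : X → ℕ → ℝ} (hf : RFun C f) {v : X → ℕ} (hv : NComp C v) :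
    RComp C (fun x => f x (v x)) := hf X C _ (.refl C) v hv

theorem NComp.congr {C : Ctx X} {f g : X → ℕ} (hf : NComp C f)
    (h : ∀ x s, C.rep x s → f x = g x) : NComp C g := by
  refine ⟨?_, fun L hL => (hf.2 L hL).conseq le_rfl (fun _ _ h => h) ?_⟩
  · obtain ⟨p, hp⟩ := hf.1
    exact ⟨p, fun x s hs => h x s hs ▸ hp x s hs⟩
  · intro x s s' hs _ hx
    rw [hx, h x s hs]

theorem RComp.congr {C : Ctx X} {f g : X → ℝ} (hf : RComp C f)
    (h : ∀ x s, C.rep x s → f x = g x) : RComp C g := fun L hL =>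
  (hf L hL).conseq le_rfl (fun _ _ h => h) fun x s s' hs _ hx => by rw [hx, h x s hs]

theorem TComp.congr {C : Ctx X} {p q : X → Prop} (hp : TComp C p)
    (h : ∀ x s, C.rep x s → (p x ↔ q x)) : TComp C q :=
  by classical exact NComp.congr hp fun x s hs => if_congr (h x s hs) rfl rfl

/-- A frame rule: facts about the arrays below `L` survive, so several intermediate results can be
held at increasing levels. -/
theorem NComp.run {C : Ctx X} {f : X → ℕ} (hf : NComp C f) {L : ℕ} (hL : C.level ≤ L)
    {R : X → State → Prop} (hR : ∀ x s, R x s → C.rep x s) (hs : ∀ x, Stable L (R x)) :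
    Does R C.size L (fun x s => R x s ∧ s.nat L 0 = f x) :=
  (hf.2 L hL).conseq le_rfl hR fun x s s' h1 h2 h3 => ⟨hs x s s' h2 h1, h3⟩

theorem RComp.run {C : Ctx X} {f : X → ℝ} (hf : RComp C f) {L : ℕ} (hL : C.level ≤ L)
    {R : X → State → Prop} (hR : ∀ x s, R x s → C.rep x s) (hs : ∀ x, Stable L (R x)) :
    Does R C.size L (fun x s => R x s ∧ s.real L 0 = f x) :=
  (hf L hL).conseq le_rfl hR fun x s s' h1 h2 h3 => ⟨hs x s s' h2 h1, h3⟩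

theorem NComp.run_self {C : Ctx X} {f : X → ℕ} (hf : NComp C f) {L : ℕ} (hL : C.level ≤ L) :
    Does C.rep C.size L (fun x s => C.rep x s ∧ s.nat L 0 = f x) :=
  hf.run hL (fun _ _ h => h) fun x => (C.stable x).mono hL

theorem RComp.run_self {C : Ctx X} {f : X → ℝ} (hf : RComp C f) {L : ℕ} (hL : C.level ≤ L) :
    Does C.rep C.size L (fun x s => C.rep x s ∧ s.real L 0 = f x) :=
  hf.run hL (fun _ _ h => h) fun x => (C.stable x).mono hL

open Classical in
theorem TFun.nfun {C : Ctx X} {p : X → ℕ → Prop} (hp : TFun C p) :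
    NFun C (fun x i => if p x i then 1 else 0) := hp

/-! ### Constants, arithmetic, comparisons and case distinctions -/

section Basic

variable {C : Ctx X}

theorem NComp.const (c : ℕ) : NComp C (fun _ => c) :=
  ⟨⟨Polynomial.C c, by simp⟩, fun L _ => .setNat le_rfl (.const 0) (.const c) fun x s _ => by
    simp [State.updNat_nat, NatExp.eval]⟩

theorem RComp.const (c : ℚ) : RComp C (fun _ => (c : ℝ)) :=
  fun L _ => .setReal le_rfl (.const 0) (.const c) fun x s _ => by
    simp [State.updReal_real, NatExp.eval, RealExp.eval]

/-- Evaluation of two natural numbers, followed by one more step. -/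
theorem NComp.run₂ {f g : X → ℕ} (hf : NComp C f) (hg : NComp C g) {L : ℕ} (hL : C.level ≤ L)
    {post : X → State → Prop}
    (h : Does (fun x s => C.rep x s ∧ s.nat L 0 = f x ∧ s.nat (L + 1) 0 = g x) C.size L post) :
    Does C.rep C.size L post := by
  have h1 := hf.run_self hL
  have h2 := hg.run (L := L + 1) (by omega) (R := fun x s => C.rep x s ∧ s.nat L 0 = f x)
    (fun _ _ h => h.1)
    (fun x => ((C.stable x).mono (by omega)).and (.nat_eq (by omega) _ _))
  refine h1.seq (Does.seq (h2.conseq (by omega) (fun _ _ h => h) ?_) h)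
  exact fun x s s' _ _ h => ⟨h.1.1, h.1.2, h.2⟩

theorem RComp.run₂ {f g : X → ℝ} (hf : RComp C f) (hg : RComp C g) {L : ℕ} (hL : C.level ≤ L)
    {post : X → State → Prop}
    (h : Does (fun x s => C.rep x s ∧ s.real L 0 = f x ∧ s.real (L + 1) 0 = g x) C.size L post) :
    Does C.rep C.size L post := by
  have h1 := hf.run_self hL
  have h2 := hg.run (L := L + 1) (by omega) (R := fun x s => C.rep x s ∧ s.real L 0 = f x)
    (fun _ _ h => h.1)
    (fun x => ((C.stable x).mono (by omega)).and (.real_eq (by omega) _ _))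
  refine h1.seq (Does.seq (h2.conseq (by omega) (fun _ _ h => h) ?_) h)
  exact fun x s s' _ _ h => ⟨h.1.1, h.1.2, h.2⟩

theorem NComp.add {f g : X → ℕ} (hf : NComp C f) (hg : NComp C g) :
    NComp C (fun x => f x + g x) := by
  refine ⟨?_, fun L hL => hf.run₂ hg hL (.setNat le_rfl (.const 0)
    (.add (.get L (.const 0)) (.get (L + 1) (.const 0))) ?_)⟩
  · obtain ⟨p, hp⟩ := hf.1
    obtain ⟨q, hq⟩ := hg.1
    exact ⟨p + q, fun x s hs => by
      rw [Polynomial.eval_add]; exact add_le_add (hp x s hs) (hq x s hs)⟩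
  · rintro x s ⟨_, h1, h2⟩
    simp [State.updNat_nat, NatExp.eval, h1, h2]

theorem NComp.sub {f g : X → ℕ} (hf : NComp C f) (hg : NComp C g) :
    NComp C (fun x => f x - g x) := by
  refine ⟨?_, fun L hL => hf.run₂ hg hL (.setNat le_rfl (.const 0)
    (.sub (.get L (.const 0)) (.get (L + 1) (.const 0))) ?_)⟩
  · obtain ⟨p, hp⟩ := hf.1
    exact ⟨p, fun x s hs => (Nat.sub_le _ _).trans (hp x s hs)⟩
  · rintro x s ⟨_, h1, h2⟩
    simp [State.updNat_nat, NatExp.eval, h1, h2]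

theorem RComp.add {f g : X → ℝ} (hf : RComp C f) (hg : RComp C g) :
    RComp C (fun x => f x + g x) := fun L hL => hf.run₂ hg hL (.setReal le_rfl (.const 0)
    (.add (.get L (.const 0)) (.get (L + 1) (.const 0))) (by
      rintro x s ⟨_, h1, h2⟩
      simp [State.updReal_real, NatExp.eval, RealExp.eval, h1, h2]))

theorem RComp.mul {f g : X → ℝ} (hf : RComp C f) (hg : RComp C g) :
    RComp C (fun x => f x * g x) := fun L hL => hf.run₂ hg hL (.setReal le_rfl (.const 0)
    (.mul (.get L (.const 0)) (.get (L + 1) (.const 0))) (by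
      rintro x s ⟨_, h1, h2⟩
      simp [State.updReal_real, NatExp.eval, RealExp.eval, h1, h2]))

theorem RComp.div {f g : X → ℝ} (hf : RComp C f) (hg : RComp C g) :
    RComp C (fun x => f x / g x) := fun L hL => hf.run₂ hg hL (.setReal le_rfl (.const 0)
    (.div (.get L (.const 0)) (.get (L + 1) (.const 0))) (by
      rintro x s ⟨_, h1, h2⟩
      simp [State.updReal_real, NatExp.eval, RealExp.eval, h1, h2]))

/-- The hypothesis `h` stands for the evaluation of the operands: it prefixes this evaluation to any
program that relies on `t L` reflecting `p`. -/
theorem TComp.of_test {p : X → Prop} (t : ℕ → Test)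
    (h : ∀ L, C.level ≤ L → ∀ post,
      Does (fun x s => C.rep x s ∧ ((t L).eval s ↔ p x)) C.size L post →
      Does C.rep C.size L post) : TComp C p := by
  classical
  refine ⟨⟨Polynomial.C 1, fun x s _ => by simp only [Polynomial.eval_C]; split_ifs <;> omega⟩,
    fun L hL => h L hL _ (.ite (t L) ?_ ?_)⟩
  · refine .setNat le_rfl (.const 0) (.const 1) ?_
    rintro x s ⟨⟨_, h1⟩, h2⟩
    simp [State.updNat_nat, NatExp.eval, h1.1 h2]
  · refine .setNat le_rfl (.const 0) (.const 0) ?_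
    rintro x s ⟨⟨_, h1⟩, h2⟩
    rw [h1] at h2
    simp [State.updNat_nat, NatExp.eval, h2]

theorem TComp.lt {f g : X → ℕ} (hf : NComp C f) (hg : NComp C g) :
    TComp C (fun x => f x < g x) :=
  .of_test (fun L => .natLt (.get L (.const 0)) (.get (L + 1) (.const 0))) fun L hL post h =>
    hf.run₂ hg hL (h.conseq le_rfl (by
      rintro x s ⟨h0, h1, h2⟩
      exact ⟨h0, by simp [Test.eval, NatExp.eval, h1, h2]⟩) (fun _ _ _ _ _ h => h))

theorem TComp.real_lt {f g : X → ℝ} (hf : RComp C f) (hg : RComp C g) :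
    TComp C (fun x => f x < g x) :=
  .of_test (fun L => .realLt (.get L (.const 0)) (.get (L + 1) (.const 0))) fun L hL post h =>
    hf.run₂ hg hL (h.conseq le_rfl (by
      rintro x s ⟨h0, h1, h2⟩
      exact ⟨h0, by simp [Test.eval, NatExp.eval, RealExp.eval, h1, h2]⟩)
      (fun _ _ _ _ _ h => h))

theorem TComp.not {p : X → Prop} (hp : TComp C p) : TComp C (fun x => ¬ p x) := by
  classical
  refine NComp.congr ((NComp.const 1).sub hp) fun x _ _ => ?_
  by_cases h : p x <;> simp [h]

theorem TComp.and {p q : X → Prop} (hp : TComp C p) (hq : TComp C q) :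
    TComp C (fun x => p x ∧ q x) := by
  classical
  refine (TComp.lt (NComp.const 1) (NComp.add hp hq)).congr fun x _ _ => ?_
  by_cases h : p x <;> by_cases h' : q x <;> simp [h, h']

theorem TComp.or {p q : X → Prop} (hp : TComp C p) (hq : TComp C q) :
    TComp C (fun x => p x ∨ q x) :=
  (hp.not.and hq.not).not.congr fun _ _ _ => by tauto

theorem TComp.const (p : Prop) : TComp C (fun _ => p) := by
  classical
  by_cases h : p
  · exact (NComp.const 1).congr fun _ _ _ => by simp [h]
  · exact (NComp.const 0).congr fun _ _ _ => by simp [h]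

theorem TComp.le {f g : X → ℕ} (hf : NComp C f) (hg : NComp C g) :
    TComp C (fun x => f x ≤ g x) :=
  (TComp.lt hg hf).not.congr fun _ _ _ => not_lt

theorem TComp.eq {f g : X → ℕ} (hf : NComp C f) (hg : NComp C g) :
    TComp C (fun x => f x = g x) :=
  ((TComp.le hf hg).and (TComp.le hg hf)).congr fun _ _ _ => le_antisymm_iff.symm

theorem TComp.real_le {f g : X → ℝ} (hf : RComp C f) (hg : RComp C g) :
    TComp C (fun x => f x ≤ g x) :=
  (TComp.real_lt hg hf).not.congr fun _ _ _ => not_lt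

/-- Conditional execution, controlled by a decidable predicate. -/
theorem TComp.cond {p : X → Prop} (hp : TComp C p) {L : ℕ} (hL : C.level ≤ L)
    {post : X → State → Prop}
    (h₁ : Does (fun x s => C.rep x s ∧ p x) C.size L post)
    (h₂ : Does (fun x s => C.rep x s ∧ ¬ p x) C.size L post) : Does C.rep C.size L post := by
  classical
  refine (NComp.run hp hL (fun _ _ h => h) (fun x => (C.stable x).mono hL)).seq
    (.ite (.natLt (.const 0) (.get L (.const 0))) (h₁.conseq le_rfl ?_ fun _ _ _ _ _ h => h)
      (h₂.conseq le_rfl ?_ fun _ _ _ _ _ h => h))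
  · rintro x s ⟨⟨h1, h2⟩, h3⟩
    refine ⟨h1, ?_⟩
    by_contra h
    simp [Test.eval, NatExp.eval, h2, h] at h3
  · rintro x s ⟨⟨h1, h2⟩, h3⟩
    refine ⟨h1, fun h => ?_⟩
    simp [Test.eval, NatExp.eval, h2, h] at h3

theorem NComp.ite {p : X → Prop} {_ : ∀ x, Decidable (p x)} {f g : X → ℕ}
    (hp : TComp C p) (hf : NComp C f)
    (hg : NComp C g) : NComp C (fun x => if p x then f x else g x) := by
  refine ⟨?_, fun L hL => hp.cond hL ((hf.2 L hL).conseq le_rfl (fun _ _ h => h.1) ?_)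
    ((hg.2 L hL).conseq le_rfl (fun _ _ h => h.1) ?_)⟩
  · obtain ⟨u, hu⟩ := hf.1
    obtain ⟨v, hv⟩ := hg.1
    refine ⟨u + v, fun x s hs => ?_⟩
    have := hu x s hs
    have := hv x s hs
    rw [Polynomial.eval_add]
    beta_reduce
    split_ifs <;> omega
  · intro x s s' h _ h'
    simp [h.2, h']
  · intro x s s' h _ h'
    simp [h.2, h']

theorem RComp.ite {p : X → Prop} {_ : ∀ x, Decidable (p x)} {f g : X → ℝ}
    (hp : TComp C p) (hf : RComp C f)
    (hg : RComp C g) : RComp C (fun x => if p x then f x else g x) := by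
  refine fun L hL => hp.cond hL ((hf L hL).conseq le_rfl (fun _ _ h => h.1) ?_)
    ((hg L hL).conseq le_rfl (fun _ _ h => h.1) ?_)
  · intro x s s' h _ h'
    simp [h.2, h']
  · intro x s s' h _ h'
    simp [h.2, h']

end Basic

end

end MarkovLogic

namespace MarkovLogic

noncomputable section

variable {X Y Z : Type} {C : Ctx X}

/-! ### Loops and tables -/

/-- The context of the body of a loop: counter in `nat (L + 1) 0`, bound in `nat (L + 2) 0`. -/
def Ctx.loop (C : Ctx X) (b : X → ℕ) {L : ℕ} (hL : C.level ≤ L) (inv : X → ℕ → State → Prop)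
    (hinv : ∀ x i, Stable (L + 1) (inv x i)) : Ctx (X × ℕ) where
  rep z s := C.rep z.1 s ∧ inv z.1 z.2 s ∧ s.nat (L + 1) 0 = z.2 ∧ s.nat (L + 2) 0 = b z.1 ∧
    z.2 < b z.1
  size z := C.size z.1
  level := L + 3
  stable z := ((C.stable z.1).mono (by omega)).and (((hinv z.1 z.2).mono (by omega)).and
    ((Stable.nat_eq (by omega) _ _).and ((Stable.nat_eq (by omega) _ _).and (.const _ _))))

section Loop

variable {b : X → ℕ} {L : ℕ} {hL : C.level ≤ L} {inv : X → ℕ → State → Prop}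
  {hinv : ∀ x i, Stable (L + 1) (inv x i)}

theorem Ctx.loop_ext : Ext (C.loop b hL inv hinv) C Prod.fst :=
  ⟨fun _ _ h => h.1, fun _ => rfl, hL.trans (Nat.le_add_right L 3)⟩

/-- The clause `z.2 < b z.1` of the loop context supplies the polynomial bound that `NComp`
requires. -/
theorem Ctx.loop_counter (hb : NComp C b) : NComp (C.loop b hL inv hinv) Prod.snd := by
  refine ⟨?_, fun L' hL' => .setNat le_rfl (.const 0) (.get (L + 1) (.const 0)) ?_⟩
  · obtain ⟨p, hp⟩ := hb.1
    exact ⟨p, fun z s hs => hs.2.2.2.2.le.trans (hp z.1 s hs.1)⟩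
  · rintro z s ⟨-, -, h, -⟩
    simp [State.updNat_nat, NatExp.eval, h]

/-- Counter and bound lie in arrays `L + 1` and `L + 2`, out of reach of `inv`, which concerns the
arrays up to `L`. The body may write anywhere from `L` on, but must return with both intact. -/
theorem Does.forLoop (hb : NComp C b) (hL : C.level ≤ L)
    (hinv : ∀ x i, Stable (L + 1) (inv x i))
    (h0 : Does C.rep C.size L (fun x s => inv x 0 s))
    (hbody : Does (C.loop b hL inv hinv).rep (C.loop b hL inv hinv).size L
      (fun z s => inv z.1 (z.2 + 1) s ∧ s.nat (L + 1) 0 = z.2 ∧ s.nat (L + 2) 0 = b z.1)) :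
    Does C.rep C.size L (fun x s => inv x (b x) s) := by
  set I : X → ℕ → State → Prop := fun x i s =>
    C.rep x s ∧ inv x i s ∧ s.nat (L + 1) 0 = i ∧ s.nat (L + 2) 0 = b x with hI
  have hC : ∀ x, Stable L (C.rep x) := fun x => (C.stable x).mono hL
  have s0 : Does C.rep C.size L (fun x s => C.rep x s ∧ inv x 0 s) :=
    h0.conseq le_rfl (fun _ _ h => h) fun x s s' h1 h2 h3 => ⟨hC x s s' h2 h1, h3⟩
  have s1 : Does (fun x s => C.rep x s ∧ inv x 0 s) C.size L
      (fun x s => (C.rep x s ∧ inv x 0 s) ∧ s.nat (L + 2) 0 = b x) :=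
    (hb.run (L := L + 2) (by omega) (fun _ _ h => h.1)
      (fun x => ((C.stable x).mono (by omega)).and ((hinv x 0).mono (by omega)))).conseq
      (by omega) (fun _ _ h => h) (fun _ _ _ _ _ h => h)
  have s2 : Does (fun x s => (C.rep x s ∧ inv x 0 s) ∧ s.nat (L + 2) 0 = b x) C.size L
      (fun x s => I x 0 s) := by
    refine .setNat (k := L + 1) (by omega) (.const 0) (.const 0) ?_
    rintro x s ⟨⟨h1, h2⟩, h3⟩
    have hs : AgreeBelow (L + 1) s (s.updNat (L + 1) 0 0) := agreeBelow_updNat le_rfl s 0 0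
    exact ⟨hC x _ _ (hs.mono (by omega)) h1, hinv x 0 _ _ hs h2,
      by simp [State.updNat_nat, NatExp.eval], by simpa [State.updNat_nat, NatExp.eval] using h3⟩
  have s3 : Does (fun (z : X × ℕ) s => I z.1 z.2 s ∧ z.2 < b z.1) (fun z => C.size z.1) L
      (fun z s => I z.1 (z.2 + 1) s) := by
    refine Does.seq (mid := fun z s => C.rep z.1 s ∧ inv z.1 (z.2 + 1) s ∧
      s.nat (L + 1) 0 = z.2 ∧ s.nat (L + 2) 0 = b z.1) (hbody.conseq le_rfl ?_ ?_)
      (.setNat (k := L + 1) (by omega) (.const 0) (.add (.get (L + 1) (.const 0)) (.const 1)) ?_)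
    · rintro z s ⟨⟨h1, h2, h3, h4⟩, h5⟩
      exact ⟨h1, h2, h3, h4, h5⟩
    · rintro z s s' ⟨⟨h1, -⟩, -⟩ h2 h3
      exact ⟨hC _ s s' h2 h1, h3⟩
    · rintro z s ⟨h1, h2, h3, h4⟩
      have hs := agreeBelow_updNat (L := L + 1) le_rfl s 0 (z.2 + 1)
      simp only [NatExp.eval, h3]
      exact ⟨hC _ _ _ (hs.mono (by omega)) h1, hinv _ _ _ _ hs h2,
        by simp [State.updNat_nat], by simpa [State.updNat_nat] using h4⟩
  have s4 := Does.whileLt (I := L + 1) (J := L + 2) (inv := I) (fun x i s h => h.2.2)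
    (by
      obtain ⟨p, hp⟩ := hb.1
      exact ⟨p, fun x s hs => hp x s hs.1⟩) s3
  exact s0.seq (s1.seq (s2.seq (s4.conseq le_rfl (fun _ _ h => h) fun _ _ _ _ _ h => h.2.1)))

end Loop

theorem NComp.sum_range {b : X → ℕ} {f : X → ℕ → ℕ} (hb : NComp C b) (hf : NFun C f) :
    NComp C (fun x => ∑ i ∈ Finset.range (b x), f x i) := by
  have hf' : ∀ {L} (hL : C.level ≤ L) {inv} (hinv : ∀ x i, Stable (L + 1) (inv x i)),
      NComp (C.loop b hL inv hinv) (fun z => f z.1 z.2) := fun hL _ hinv =>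
    hf _ _ _ Ctx.loop_ext _ (Ctx.loop_counter hb)
  refine ⟨?_, fun L hL => ?_⟩
  · obtain ⟨p, hp⟩ := hb.1
    obtain ⟨q, hq⟩ := (hf' le_rfl (inv := fun _ _ _ => True) (fun _ _ => .const _ _)).1
    refine ⟨p * q, fun x s hs => ?_⟩
    rw [Polynomial.eval_mul]
    refine (Finset.sum_le_card_nsmul _ _ (q.eval (C.size x)) fun i hi => ?_).trans ?_
    -- The bound `q` holds only for pairs that some memory represents; writing the counter `i` and
    -- the bound `b x` into `s` produces such a memory.
    · have hs' := agreeBelow_updNat (L := C.level) (k := C.level + 1) (by omega) s 0 i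
      have hs'' := agreeBelow_updNat (L := C.level) (k := C.level + 2) (by omega)
        (s.updNat (C.level + 1) 0 i) 0 (b x)
      exact hq (x, i) ((s.updNat (C.level + 1) 0 i).updNat (C.level + 2) 0 (b x))
        ⟨C.stable x _ _ (hs'.trans hs'') hs, trivial, by simp [State.updNat_nat],
          by simp [State.updNat_nat], by simpa using hi⟩
    · simpa using Nat.mul_le_mul_right _ (hp x s hs)
  · refine Does.forLoop (inv := fun x i s => s.nat L 0 = ∑ j ∈ Finset.range i, f x j) hb hL
      (fun x i => .nat_eq (by omega) _ _) ?_ ?_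
    · exact .setNat le_rfl (.const 0) (.const 0) fun x s _ => by
        simp [State.updNat_nat, NatExp.eval]
    · refine (((hf' hL _).run_self (L := L + 3) le_rfl).conseq (Nat.le_add_right L 3)
        (fun _ _ h => h)
        (fun _ _ _ _ _ h => h)).seq (.setNat le_rfl (.const 0)
          (.add (.get L (.const 0)) (.get (L + 3) (.const 0))) ?_)
      rintro z s ⟨⟨-, h1, h2, h3, -⟩, h4⟩
      simp [State.updNat_nat, NatExp.eval, h1, h2, h3, h4, Finset.sum_range_succ]

theorem RComp.prod_range {b : X → ℕ} {f : X → ℕ → ℝ} (hb : NComp C b) (hf : RFun C f) :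
    RComp C (fun x => ∏ i ∈ Finset.range (b x), f x i) := fun L hL => by
  refine Does.forLoop (inv := fun x i s => s.real L 0 = ∏ j ∈ Finset.range i, f x j) hb hL
    (fun x i => .real_eq (by omega) _ _) ?_ ?_
  · exact .setReal le_rfl (.const 0) (.const 1) fun x s _ => by
      simp [State.updReal_real, NatExp.eval, RealExp.eval]
  · refine ((RComp.run_self (hf _ _ _ Ctx.loop_ext _ (Ctx.loop_counter hb)) (L := L + 3)
      le_rfl).conseq (Nat.le_add_right L 3) (fun _ _ h => h)
      (fun _ _ _ _ _ h => h)).seq (.setReal le_rfl (.const 0)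
        (.mul (.get L (.const 0)) (.get (L + 3) (.const 0))) ?_)
    rintro z s ⟨⟨-, h1, h2, h3, -⟩, h4⟩
    simp [State.updReal_real, State.updReal_nat, NatExp.eval, RealExp.eval, h1, h2, h3, h4,
      Finset.prod_range_succ]

/-- The first `b x` values of `a x` can be stored in an array, each computed from the preceding
ones, and then be used in the computation of `h`. -/
theorem RComp.table {b : X → ℕ} {a : X → ℕ → ℝ} {h : X → ℝ} (hb : NComp C b)
    (hstep : ∀ (Y : Type) (E : Ctx Y) (π : Y → X) (v : Y → ℕ), Ext E C π → NComp E v →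
      RFun E (fun y i => if i < v y then a (π y) i else 0) →
      (∀ y s, E.rep y s → v y < b (π y)) → RComp E (fun y => a (π y) (v y)))
    (huse : ∀ E : Ctx X, Ext E C (fun x => x) →
      RFun E (fun x i => if i < b x then a x i else 0) → RComp E h) :
    RComp C h := fun L hL => by
  classical
  -- Reading the table is guarded by a test, so cells that are not yet filled do not matter. It
  -- works in all extensions of `E`, because array `k` lies below the level of `E`.
  have hlook : ∀ {Y : Type} {E : Ctx Y} {π : Y → X} {v : Y → ℕ} {k : ℕ}, NComp E v →
      k < E.level → (∀ y s, E.rep y s → ∀ i < v y, s.real k i = a (π y) i) →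
      RFun E (fun y i => if i < v y then a (π y) i else 0) := by
    intro Y E π v k hv hk hrep Z E' π' hE u hu L' hL'
    refine (TComp.lt hu (hv.ext hE)).cond hL'
      (((hu.run hL' (R := fun z s => E'.rep z s ∧ u z < v (π' z)) (fun _ _ h => h.1)
        (fun z => ((E'.stable z).mono hL').and (.const _ _)))).seq
        (.setReal le_rfl (.const 0) (.get k (.get L' (.const 0))) ?_))
      (.setReal le_rfl (.const 0) (.const 0) ?_)
    · rintro z s ⟨⟨h1, h2⟩, h3⟩
      simp [State.updReal_real, NatExp.eval, RealExp.eval, h2, h3,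
        hrep _ s (hE.rep z s h1) _ h2]
    · rintro z s ⟨h1, h2⟩
      simp [State.updReal_real, NatExp.eval, RealExp.eval, h2]
  have fill : Does C.rep C.size (L + 1) (fun x s => ∀ i < b x, s.real (L + 1) i = a x i) := by
    refine Does.forLoop (L := L + 1) (inv := fun x i s => ∀ j < i, s.real (L + 1) j = a x j) hb
      (by omega) (fun x i => .forall_real_eq (by omega) _ _) ?_ ?_
    · exact .setReal le_rfl (.const 0) (.const 0) fun x s _ j hj => by omega
    · refine ((RComp.run_self (hstep _ _ _ _ Ctx.loop_ext (Ctx.loop_counter hb) (hlook (k := L + 1)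
        (Ctx.loop_counter hb) (by simp only [Ctx.loop]; omega) fun y s hs => hs.2.1)
        fun y s hs => hs.2.2.2.2) (L := L + 1 + 3) le_rfl).conseq (Nat.le_add_right _ 3)
        (fun _ _ h => h)
        (fun _ _ _ _ _ h => h)).seq (.setReal le_rfl (.get (L + 1 + 1) (.const 0))
          (.get (L + 1 + 3) (.const 0)) ?_)
      rintro z s ⟨⟨-, h1, h2, h3, -⟩, h4⟩
      refine ⟨fun j hj => ?_, by simpa [State.updReal_nat] using h2,
        by simpa [State.updReal_nat] using h3⟩
      simp only [State.updReal_real, NatExp.eval, RealExp.eval, h2, true_and, h4]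
      split_ifs with hjz
      · rw [hjz]
      · exact h1 j (by omega)
  let E : Ctx X :=
    { rep := fun x s => C.rep x s ∧ ∀ i < b x, s.real (L + 1) i = a x i
      size := C.size
      level := L + 2
      stable := fun x => ((C.stable x).mono (by omega)).and (.forall_real_eq (by omega) _ _) }
  have hE : Ext E C (fun x => x) :=
    ⟨fun _ _ h => h.1, fun _ => rfl, hL.trans (Nat.le_add_right L 2)⟩
  have hh := huse E hE (hlook (π := fun x => x) (k := L + 1) (hb.ext hE) (Nat.lt_succ_self _)
    fun y s hs => hs.2)
  refine Does.seq (mid := E.rep) (fill.conseq (by omega) (fun _ _ h => h) ?_)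
    (((hh (L + 2) le_rfl).conseq (Nat.le_add_right L 2) (fun _ _ h => h)
      (fun _ _ _ _ _ h => h)).seq
      (.setReal le_rfl (.const 0) (.get (L + 2) (.const 0)) ?_))
  · exact fun x s s' h1 h2 h3 => ⟨C.stable x _ _ (h2.mono (by omega)) h1, h3⟩
  · intro x s hx
    simp [State.updReal_real, NatExp.eval, RealExp.eval, hx]

/-! ### Further closure properties -/

theorem NComp.nfun {f : X → ℕ} (hf : NComp C f) : NFun C (fun x _ => f x) :=
  fun _ _ _ h _ _ => hf.ext h

theorem RComp.rfun {f : X → ℝ} (hf : RComp C f) : RFun C (fun x _ => f x) :=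
  fun _ _ _ h _ _ => hf.ext h

/-- The machine does not multiply natural numbers, so a product is computed as a repeated sum. -/
theorem NComp.mul {f g : X → ℕ} (hf : NComp C f) (hg : NComp C g) :
    NComp C (fun x => f x * g x) :=
  (NComp.sum_range hf hg.nfun).congr fun x _ _ => by simp

theorem NComp.pow_const {f : X → ℕ} (hf : NComp C f) (k : ℕ) : NComp C (fun x => f x ^ k) := by
  induction k with
  | zero => simpa using NComp.const 1
  | succ k ih => simpa only [pow_succ] using ih.mul hf

theorem RComp.pow {f : X → ℝ} {g : X → ℕ} (hf : RComp C f) (hg : NComp C g) :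
    RComp C (fun x => f x ^ g x) :=
  (RComp.prod_range hg hf.rfun).congr fun x _ _ => by simp

theorem TComp.exists_lt {b : X → ℕ} {p : X → ℕ → Prop} (hb : NComp C b) (hp : TFun C p) :
    TComp C (fun x => ∃ i < b x, p x i) := by
  classical
  refine (TComp.lt (NComp.const 0) (NComp.sum_range hb hp.nfun)).congr fun x _ _ => ?_
  rw [Finset.sum_pos_iff]
  simp only [Finset.mem_range]
  refine exists_congr fun i => and_congr_right fun _ => ?_
  by_cases h : p x i <;> simp [h]

theorem TComp.forall_lt {b : X → ℕ} {p : X → ℕ → Prop} (hb : NComp C b) (hp : TFun C p) :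
    TComp C (fun x => ∀ i < b x, p x i) :=
  (TComp.exists_lt hb (p := fun x i => ¬ p x i) fun Y E π h v hv => (hp Y E π h v hv).not).not.congr
    fun x _ _ => by push Not; rfl

theorem NComp.card_filter {b : X → ℕ} {p : X → ℕ → Prop} {dec : ∀ x, DecidablePred (p x)}
    (hb : NComp C b) (hp : TFun C p) :
    NComp C (fun x => ((Finset.range (b x)).filter (p x)).card) := by
  refine (NComp.sum_range hb hp.nfun).congr fun x _ _ => ?_
  rw [Finset.card_filter]
  exact Finset.sum_congr rfl fun i _ => by by_cases h : p x i <;> simp [h]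

/-- The quotient counts the `i` with `(i + 1) * g ≤ f`, all of which are below `f`. The clause `0 <
g` yields the convention `f / 0 = 0`. -/
theorem NComp.div {f g : X → ℕ} (hf : NComp C f) (hg : NComp C g) :
    NComp C (fun x => f x / g x) := by
  classical
  have h : TFun C (fun x i => 0 < g x ∧ (i + 1) * g x ≤ f x) := fun Y E π h v hv =>
    (TComp.lt (NComp.const 0) (hg.ext h)).and
      (TComp.le ((hv.add (.const 1)).mul (hg.ext h)) (hf.ext h))
  refine (NComp.card_filter (dec := fun _ _ => instDecidableAnd) hf h).congr fun x _ _ => ?_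
  rcases Nat.eq_zero_or_pos (g x) with h0 | h0
  · simp [h0]
  · have : Finset.filter (fun i => 0 < g x ∧ (i + 1) * g x ≤ f x) (Finset.range (f x)) =
        Finset.range (f x / g x) := by
      ext i
      simp only [Finset.mem_filter, Finset.mem_range, h0, true_and]
      rw [← Nat.succ_le_iff (n := f x / g x), Nat.le_div_iff_mul_le h0]
      refine ⟨fun h => h.2, fun h => ⟨?_, h⟩⟩
      exact Nat.lt_of_succ_le ((Nat.le_mul_of_pos_right _ h0).trans h)
    rw [this, Finset.card_range]

theorem NComp.mod {f g : X → ℕ} (hf : NComp C f) (hg : NComp C g) :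
    NComp C (fun x => f x % g x) :=
  (hf.sub (hg.mul (hf.div hg))).congr fun x _ _ => by
    have := Nat.div_add_mod (f x) (g x)
    omega

theorem NComp.sum_finset {ι : Type*} {f : ι → X → ℕ} (t : Finset ι)
    (hf : ∀ a ∈ t, NComp C (f a)) : NComp C (fun x => ∑ a ∈ t, f a x) := by
  classical
  induction t using Finset.induction_on with
  | empty => simpa using NComp.const 0
  | insert a t ha ih =>
    simp only [Finset.sum_insert ha]
    exact (hf a (Finset.mem_insert_self a t)).add
      (ih fun a' h => hf a' (Finset.mem_insert_of_mem h))

theorem RComp.sum_finset {ι : Type*} {f : ι → X → ℝ} (t : Finset ι)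
    (hf : ∀ a ∈ t, RComp C (f a)) : RComp C (fun x => ∑ a ∈ t, f a x) := by
  classical
  induction t using Finset.induction_on with
  | empty => simpa using RComp.const 0
  | insert a t ha ih =>
    simp only [Finset.sum_insert ha]
    exact (hf a (Finset.mem_insert_self a t)).add
      (ih fun a' h => hf a' (Finset.mem_insert_of_mem h))

theorem RComp.prod_finset {ι : Type*} {f : ι → X → ℝ} (t : Finset ι)
    (hf : ∀ a ∈ t, RComp C (f a)) : RComp C (fun x => ∏ a ∈ t, f a x) := by
  classical
  induction t using Finset.induction_on with
  | empty => simpa using RComp.const 1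
  | insert a t ha ih =>
    simp only [Finset.prod_insert ha]
    exact (hf a (Finset.mem_insert_self a t)).mul
      (ih fun a' h => hf a' (Finset.mem_insert_of_mem h))

theorem RComp.sum {ι : Type*} [Fintype ι] {f : ι → X → ℝ} (hf : ∀ a, RComp C (f a)) :
    RComp C (fun x => ∑ a, f a x) := .sum_finset _ fun a _ => hf a

theorem RComp.prod {ι : Type*} [Fintype ι] {f : ι → X → ℝ} (hf : ∀ a, RComp C (f a)) :
    RComp C (fun x => ∏ a, f a x) := .prod_finset _ fun a _ => hf a

theorem TComp.exists {ι : Type*} [Finite ι] {p : ι → X → Prop} (hp : ∀ a, TComp C (p a)) :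
    TComp C (fun x => ∃ a, p a x) := by
  classical
  have := Fintype.ofFinite ι
  refine (TComp.lt (NComp.const 0) (NComp.sum_finset Finset.univ fun a _ => hp a)).congr
    fun x _ _ => ?_
  rw [Finset.sum_pos_iff]
  simp only [Finset.mem_univ, true_and]
  refine exists_congr fun i => ?_
  by_cases h : p i x <;> simp [h]

theorem TComp.forall {ι : Type*} [Finite ι] {p : ι → X → Prop} (hp : ∀ a, TComp C (p a)) :
    TComp C (fun x => ∀ a, p a x) :=
  (TComp.exists fun a => (hp a).not).not.congr fun x _ _ => by push Not; rfl

theorem TComp.iff_const {p : X → Prop} (hp : TComp C p) (q : Prop) :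
    TComp C (fun x => p x ↔ q) := by
  by_cases h : q
  · simpa [h] using hp
  · simpa [h] using hp.not

open Classical in
/-- The first number below `b` with the property `p`, or `b` if there is none. -/
def firstBelow (b : ℕ) (p : ℕ → Prop) : ℕ :=
  ((Finset.range b).filter fun i => ∀ j < i + 1, ¬ p j).card

/-- The `i` such that `p` fails up to and including `i` form an initial segment, whose length is the
least number with `p`. -/
theorem firstBelow_spec {b : ℕ} {p : ℕ → Prop} (h : ∃ i < b, p i) :
    firstBelow b p < b ∧ p (firstBelow b p) := by
  classical
  obtain ⟨i₀, hi₀, hp₀⟩ := h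
  have hex : ∃ i, p i := ⟨i₀, hp₀⟩
  have : firstBelow b p = Nat.find hex := by
    have hf : Finset.filter (fun i => ∀ j < i + 1, ¬ p j) (Finset.range b) =
        Finset.range (Nat.find hex) := by
      ext i
      simp only [Finset.mem_filter, Finset.mem_range]
      constructor
      · rintro ⟨-, h⟩
        by_contra hlt
        exact h _ (by omega) (Nat.find_spec hex)
      · intro hi
        have := Nat.find_min' hex hp₀
        exact ⟨by omega, fun j hj => Nat.find_min hex (by omega)⟩
    rw [firstBelow, ← Finset.card_range (Nat.find hex), ← hf]
  rw [this]
  exact ⟨(Nat.find_min' hex hp₀).trans_lt hi₀, Nat.find_spec hex⟩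

theorem NComp.firstBelow {b : X → ℕ} {p : X → ℕ → Prop} (hb : NComp C b) (hp : TFun C p) :
    NComp C (fun x => firstBelow (b x) (p x)) := by
  have h : TFun C (fun x i => ∀ j < i + 1, ¬ p x j) := fun Y E π h v hv =>
    TComp.forall_lt (hv.add (.const 1)) fun Y' E' _ h' v' hv' =>
      (hp Y' E' _ (h'.trans h) v' hv').not
  classical
  exact (NComp.card_filter hb h).congr fun x _ _ => by unfold MarkovLogic.firstBelow; congr!

end

end MarkovLogic

namespace MarkovLogic

noncomputable section

/-! ### Sums over sequences of types by dynamic programming -/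

section Sequences

variable {T : Type}

/-- The weight of a sequence of types: the product of a weight of every single position and of
a weight of every pair of positions. -/
def seqWeight (α : ℕ → T → ℝ) (ρ : T → T → ℝ) {j : ℕ} (τ : Fin j → T) : ℝ :=
  ∏ d : Fin j, (α d (τ d) * ∏ c : Fin j, if c < d then ρ (τ c) (τ d) else 1)

/-- Each pair factor is charged to the later position, so the old factors are unaffected by the new
type. -/
theorem seqWeight_snoc (α : ℕ → T → ℝ) (ρ : T → T → ℝ) {j : ℕ} (τ : Fin j → T) (t : T) :
    seqWeight α ρ (Fin.snoc (α := fun _ => T) τ t) =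
      seqWeight α ρ τ * (α j t * ∏ c, ρ (τ c) t) := by
  simp only [seqWeight, Fin.prod_univ_castSucc, Fin.snoc_castSucc, Fin.snoc_last,
    Fin.val_castSucc, Fin.val_last, Fin.castSucc_lt_castSucc_iff, Fin.castSucc_lt_last,
    lt_irrefl, if_true, if_false, mul_one, (Fin.castSucc_lt_last _).asymm]

variable [Fintype T] [DecidableEq T]

/-- The total weight of all continuations, by `i` types, of a sequence of length `n - i` in which
the type `t` has been used `k t` times. -/
def restWeight (n : ℕ) (α : ℕ → T → ℝ) (ρ : T → T → ℝ) : ℕ → (T → ℕ) → ℝ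
  | 0, _ => 1
  | i + 1, k => ∑ t, if k t + 1 < n + 1 then
      α (n - (i + 1)) t * (∏ v, ρ v t ^ k v) *
        restWeight n α ρ i (Function.update k t (k t + 1)) else 0

/-- Induction on the length `j` of the explicit prefix. The factors of the next type against the
prefix, grouped by type, are powers whose exponents are the counts, so the order of the prefix is
irrelevant. -/
theorem sum_seqWeight_eq (n : ℕ) (α : ℕ → T → ℝ) (ρ : T → T → ℝ) (j : ℕ) (hj : j ≤ n) :
    restWeight n α ρ n (fun _ => 0) = ∑ τ : Fin j → T, seqWeight α ρ τ *
      restWeight n α ρ (n - j) (fun t => (Finset.univ.filter fun c => τ c = t).card) := by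
  induction j with
  | zero => simp [seqWeight]
  | succ j ih =>
    rw [ih (by omega), ← (Fin.snocEquiv (fun _ : Fin (j + 1) => T)).sum_comp,
      Fintype.sum_prod_type, Finset.sum_comm]
    refine Finset.sum_congr rfl fun τ _ => ?_
    obtain ⟨i, hi⟩ : ∃ i, n - j = i + 1 := ⟨n - j - 1, by omega⟩
    have hi' : n - (j + 1) = i := by omega
    rw [hi, restWeight, Finset.mul_sum]
    refine Finset.sum_congr rfl fun t _ => ?_
    have hcard : (Finset.univ.filter fun c => τ c = t).card ≤ j :=
      (Finset.card_le_univ _).trans_eq (Fintype.card_fin j)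
    -- For counts of a prefix of length `j < n` the guard in `restWeight` always holds. It serves to
    -- keep the counts below `n + 1` when they are coded as digits.
    rw [if_pos (by omega)]
    change _ = seqWeight α ρ (Fin.snoc (α := fun _ => T) τ t) * _
    have hprod : ∏ v, ρ v t ^ (Finset.univ.filter fun c => τ c = v).card = ∏ c, ρ (τ c) t := by
      rw [← Finset.prod_fiberwise (s := Finset.univ) (g := τ)]
      refine Finset.prod_congr rfl fun v _ => ?_
      rw [← Finset.prod_const]
      exact Finset.prod_congr rfl fun c hc => by rw [(Finset.mem_filter.1 hc).2]
    have hcount : (fun v => (Finset.univ.filter fun c =>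
        (Fin.snoc (α := fun _ => T) τ t : Fin (j + 1) → T) c = v).card) =
        Function.update (fun v => (Finset.univ.filter fun c => τ c = v).card) t
          ((Finset.univ.filter fun c => τ c = t).card + 1) := by
      funext v
      simp only [Finset.card_filter, Fin.sum_univ_castSucc, Fin.snoc_castSucc, Fin.snoc_last]
      by_cases hv : v = t
      · subst hv; simp
      · simp [hv, Ne.symm hv]
    rw [seqWeight_snoc, hprod, hi', ← hcount, show n - (i + 1) = j by omega]
    exact (mul_assoc _ _ _).symm

theorem sum_seqWeight (n : ℕ) (α : ℕ → T → ℝ) (ρ : T → T → ℝ) :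
    ∑ τ : Fin n → T, seqWeight α ρ τ = restWeight n α ρ n (fun _ => 0) := by
  rw [sum_seqWeight_eq n α ρ n le_rfl]
  simp [restWeight]

/-- Digits of `code + B ^ t`, where no carry occurs. -/
theorem digit_add_pow {B K x : ℕ} (hx : x < B ^ K) (t : Fin K)
    (ht : x / B ^ (t : ℕ) % B + 1 < B) :
    x + B ^ (t : ℕ) < B ^ K ∧ ∀ v : Fin K, (x + B ^ (t : ℕ)) / B ^ (v : ℕ) % B =
      if v = t then x / B ^ (t : ℕ) % B + 1 else x / B ^ (v : ℕ) % B := by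
  set f := (finFunctionFinEquiv (m := B) (n := K)).symm ⟨x, hx⟩ with hf
  have hfv : ∀ v, (f v : ℕ) = x / B ^ (v : ℕ) % B := fun v => rfl
  have hfx : ∑ v, (f v : ℕ) * B ^ (v : ℕ) = x := by
    rw [← finFunctionFinEquiv_apply, hf, Equiv.apply_symm_apply]
  set g := Function.update f t ⟨x / B ^ (t : ℕ) % B + 1, ht⟩ with hg
  have hgv : ∀ v, (g v : ℕ) =
      if v = t then x / B ^ (t : ℕ) % B + 1 else x / B ^ (v : ℕ) % B := fun v => by
    by_cases h : v = t
    · subst h; simp [hg]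
    · simp [hg, h, hfv]
  have hgx : ((finFunctionFinEquiv g : Fin (B ^ K)) : ℕ) = x + B ^ (t : ℕ) := by
    rw [finFunctionFinEquiv_apply]
    have : ∀ v, (g v : ℕ) * B ^ (v : ℕ) =
        (f v : ℕ) * B ^ (v : ℕ) + if v = t then B ^ (v : ℕ) else 0 := fun v => by
      rw [hgv, hfv]
      split_ifs with h
      · subst h; ring
      · ring
    simp only [this, Finset.sum_add_distrib, hfx, Finset.sum_ite_eq', Finset.mem_univ, if_true]
  refine ⟨hgx ▸ (finFunctionFinEquiv g).2, fun v => ?_⟩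
  rw [← hgv, ← hgx]
  conv_rhs => rw [← Equiv.symm_apply_apply finFunctionFinEquiv g]
  rfl

variable {X : Type} {C : Ctx X}

/-- With `K` types, counts are coded as `K` digits in base `B = n + 1`, and `i` remaining positions
add `i * M`, where `M = B ^ K`. As `K` is fixed, there are polynomially many codes, and a single
table evaluates the recursion. -/
theorem RComp.restWeight {n : X → ℕ} {α : X → ℕ → T → ℝ} {ρ : X → T → T → ℝ} (hn : NComp C n)
    (hα : ∀ t, RFun C (fun x c => α x c t)) (hρ : ∀ t t', RComp C (fun x => ρ x t t')) :
    RComp C (fun x => restWeight (n x) (α x) (ρ x) (n x) (fun _ => 0)) := by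
  classical
  set K := Fintype.card T
  set idx : T ≃ Fin K := Fintype.equivFin T
  set B : X → ℕ := fun x => n x + 1 with hB
  set M : X → ℕ := fun x => B x ^ K with hM
  have hMpos : ∀ x, 0 < M x := fun x => pow_pos (Nat.succ_pos _) _
  have cB : NComp C B := hn.add (.const 1)
  have cM : NComp C M := cB.pow_const K
  set a : X → ℕ → ℝ := fun x I => MarkovLogic.restWeight (n x) (α x) (ρ x) (I / M x)
    (fun v => I % M x / B x ^ (idx v : ℕ) % B x) with ha
  -- Using up one position and counting one more `t` moves from `I` to `I - M + B ^ idx t`. This is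
  -- smaller than `I` when the guard holds; the explicit test gives the entry the form in which
  -- `RComp.table` offers earlier ones.
  have hrec : ∀ x I, a x I = if I / M x = 0 then 1 else
      ∑ t, if I % M x / B x ^ (idx t : ℕ) % B x + 1 < B x then
        α x (n x - I / M x) t * (∏ v, ρ x v t ^ (I % M x / B x ^ (idx v : ℕ) % B x)) *
          (if I - M x + B x ^ (idx t : ℕ) < I then a x (I - M x + B x ^ (idx t : ℕ)) else 0)
        else 0 := by
    intro x I
    split_ifs with h0
    · simp only [ha, h0, MarkovLogic.restWeight]
    · obtain ⟨i, hi⟩ := Nat.exists_eq_succ_of_ne_zero h0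
      simp only [ha, hi, MarkovLogic.restWeight, Nat.succ_eq_add_one]
      refine Finset.sum_congr rfl fun t _ => ?_
      by_cases ht : I % M x / B x ^ (idx t : ℕ) % B x + 1 < B x
      · have ht' : I % M x / B x ^ (idx t : ℕ) % B x + 1 < n x + 1 := ht
        obtain ⟨h1, h2⟩ := digit_add_pow (Nat.mod_lt I (hMpos x)) (idx t) ht
        have hdm := Nat.div_add_mod I (M x)
        rw [hi, Nat.succ_eq_add_one, Nat.mul_add, Nat.mul_one] at hdm
        have hI : I - M x + B x ^ (idx t : ℕ) =
            M x * i + (I % M x + B x ^ (idx t : ℕ)) := by omega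
        have hlt : B x ^ (idx t : ℕ) < M x := lt_of_le_of_lt (Nat.le_add_left _ _) h1
        have hge : M x ≤ I := by
          have := Nat.le_add_left (M x) (M x * i)
          omega
        have hdiv : (M x * i + (I % M x + B x ^ (idx t : ℕ))) / M x = i := by
          rw [Nat.mul_add_div (hMpos x), Nat.div_eq_of_lt h1, Nat.add_zero]
        have hmod : (M x * i + (I % M x + B x ^ (idx t : ℕ))) % M x =
            I % M x + B x ^ (idx t : ℕ) := by
          rw [Nat.mul_add_mod, Nat.mod_eq_of_lt h1]
        rw [if_pos ht', if_pos ht, if_pos (by omega : I - M x + B x ^ (idx t : ℕ) < I), hI, hdiv,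
          hmod]
        congr 2
        funext v
        rw [h2]
        by_cases hv : v = t
        · subst hv; simp [hM]
        · simp [hv, hM]
      · rw [if_neg ht, if_neg (show ¬ _ < n x + 1 from ht)]
  refine RComp.table (a := a) (b := fun x => (n x + 1) * M x) ((hn.add (.const 1)).mul cM) ?_ ?_
  · intro Y E π v hE hv hget _
    have cMI : NComp E (fun y => M (π y)) := cM.ext hE
    have cBI : NComp E (fun y => B (π y)) := cB.ext hE
    have cdig : ∀ t, NComp E (fun y => v y % M (π y) / B (π y) ^ (idx t : ℕ) % B (π y)) :=
      fun t => ((hv.mod cMI).div (cBI.pow_const _)).mod cBI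
    have cidx : ∀ t, NComp E (fun y => v y - M (π y) + B (π y) ^ (idx t : ℕ)) := fun t =>
      (hv.sub cMI).add (cBI.pow_const _)
    simp only [fun y => hrec (π y) (v y)]
    exact RComp.ite (TComp.eq (hv.div cMI) (.const 0)) (by simpa using RComp.const 1)
      (RComp.sum fun t => RComp.ite (TComp.lt ((cdig t).add (.const 1)) cBI)
        ((((hα t).ext hE).app ((hn.ext hE).sub (hv.div cMI))).mul (RComp.prod fun u =>
          ((hρ u t).ext hE).pow (cdig u)) |>.mul (hget.app (cidx t)))
        (by simpa using RComp.const 0))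
  · intro E hE hget
    refine (hget.app ((hn.ext hE).mul (cM.ext hE))).congr fun x s _ => ?_
    rw [if_pos (by rw [Nat.add_mul]; have := hMpos x; omega)]
    simp only [ha, Nat.mul_div_cancel _ (hMpos x), Nat.mul_mod_left, Nat.zero_div, Nat.zero_mod]

end Sequences

end

end MarkovLogic

namespace MarkovLogic

noncomputable section

/-! ### Functions with at most two values -/

/-- Surjections onto `{0, …, k - 1}`. -/
abbrev Onto (v : Type) (k : ℕ) : Type := {σ : v → Fin k // Function.Surjective σ}

/-- Pairs of constants `c < d`. -/
abbrev Pairs (n : ℕ) : Type := {cd : Fin n × Fin n // cd.1 < cd.2}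

/-- A function with at most two values is a set of at most two values, given in increasing order,
together with a surjection. -/
def spread {v : Type} {n : ℕ} :
    Onto v 0 ⊕ (Fin n × Onto v 1) ⊕ (Pairs n × Onto v 2) → v → Fin n
  | .inl σ => fun x => (σ.1 x).elim0
  | .inr (.inl y) => fun x => ![y.1] (y.2.1 x)
  | .inr (.inr y) => fun x => ![y.1.1.1, y.1.1.2] (y.2.1 x)

/-- Surjectivity makes the set of values recoverable, and `c < d` fixes the order in which two
values are listed; this determines the surjection. -/
theorem spread_injective {v : Type} {n : ℕ} : Function.Injective (spread (v := v) (n := n)) := by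
  have hpair : ∀ (c d : Fin n), c < d → ∀ i j : Fin 2, ![c, d] i = ![c, d] j → i = j := by
    intro c d h i j
    fin_cases i <;> fin_cases j <;> simp [h.ne, h.ne']
  rintro (σ | ⟨c, σ⟩ | ⟨⟨⟨c, d⟩, h⟩, σ⟩) (σ' | ⟨c', σ'⟩ | ⟨⟨⟨c', d'⟩, h'⟩, σ'⟩) he
  · congr 1
    ext x
    exact (σ.1 x).elim0
  · obtain ⟨x, -⟩ := σ'.2 0
    exact (σ.1 x).elim0
  · obtain ⟨x, -⟩ := σ'.2 0
    exact (σ.1 x).elim0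
  · obtain ⟨x, -⟩ := σ.2 0
    exact (σ'.1 x).elim0
  · obtain ⟨x, -⟩ := σ.2 0
    have h1 := congrFun he x
    simp only [spread, Matrix.cons_val_fin_one] at h1
    subst h1
    rw [Subsingleton.elim σ σ']
  · obtain ⟨x, hx⟩ := σ'.2 0
    obtain ⟨y, hy⟩ := σ'.2 1
    have h1 := congrFun he x
    have h2 := congrFun he y
    simp only [spread, Matrix.cons_val_fin_one, hx, hy, Matrix.cons_val_zero,
      Matrix.cons_val_one] at h1 h2
    simp only at h'
    omega
  · obtain ⟨x, -⟩ := σ.2 0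
    exact (σ'.1 x).elim0
  · obtain ⟨x, hx⟩ := σ.2 0
    obtain ⟨y, hy⟩ := σ.2 1
    have h1 := congrFun he x
    have h2 := congrFun he y
    simp only [spread, Matrix.cons_val_fin_one, hx, hy, Matrix.cons_val_zero,
      Matrix.cons_val_one] at h1 h2
    simp only at h
    omega
  · simp only at h h'
    have hval : ∀ i : Fin 2, ∃ j : Fin 2, ![c, d] i = ![c', d'] j := fun i => by
      obtain ⟨x, hx⟩ := σ.2 i
      exact ⟨σ'.1 x, by have := congrFun he x; simpa only [spread, hx] using this⟩
    have hval' : ∀ i : Fin 2, ∃ j : Fin 2, ![c', d'] i = ![c, d] j := fun i => by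
      obtain ⟨x, hx⟩ := σ'.2 i
      exact ⟨σ.1 x, by have := congrFun he x; simpa only [spread, hx] using this.symm⟩
    have a0 := hval 0
    have a1 := hval 1
    have b0 := hval' 0
    have b1 := hval' 1
    simp only [Fin.exists_fin_two, Matrix.cons_val_zero, Matrix.cons_val_one] at a0 a1 b0 b1
    have hc : c = c' := by omega
    have hd : d = d' := by omega
    subst hc hd
    have : σ = σ' := Subtype.ext (funext fun x => hpair c d h _ _ (congrFun he x))
    rw [this]

theorem mem_range_spread {v : Type} [Fintype v] {n : ℕ} {f : v → Fin n} :
    f ∈ Set.range spread ↔ (Finset.univ.image f).card ≤ 2 := by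
  constructor
  · rintro ⟨σ | ⟨c, σ⟩ | ⟨⟨⟨c, d⟩, h⟩, σ⟩, rfl⟩
    · have : IsEmpty v := ⟨fun x => (σ.1 x).elim0⟩
      simp
    · refine (Finset.card_le_card (t := {c}) ?_).trans (by simp)
      intro x hx
      obtain ⟨y, -, rfl⟩ := Finset.mem_image.1 hx
      simp [spread]
    · refine (Finset.card_le_card (t := {c, d}) ?_).trans Finset.card_le_two
      intro x hx
      obtain ⟨y, -, rfl⟩ := Finset.mem_image.1 hx
      simp only [spread]
      generalize σ.1 y = i
      fin_cases i <;> simp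
  · intro h
    interval_cases hc : (Finset.univ.image f).card
    · have : IsEmpty v := by
        rw [Finset.card_eq_zero, Finset.image_eq_empty, Finset.univ_eq_empty_iff] at hc
        exact hc
      exact ⟨.inl ⟨fun x => isEmptyElim x, fun i => i.elim0⟩, funext fun x => isEmptyElim x⟩
    · obtain ⟨c, hc⟩ := Finset.card_eq_one.1 hc
      have hf : ∀ x, f x = c := fun x => by
        have := Finset.mem_image_of_mem f (Finset.mem_univ x)
        rwa [hc, Finset.mem_singleton] at this
      obtain ⟨x, -, -⟩ := Finset.mem_image.1 (hc ▸ Finset.mem_singleton_self c)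
      exact ⟨.inr (.inl (c, ⟨fun _ => 0, fun i => ⟨x, Subsingleton.elim _ _⟩⟩)),
        funext fun y => by simp [spread, hf]⟩
    · have key : ∀ c d : Fin n, c < d → Finset.univ.image f = {c, d} →
          f ∈ Set.range spread := by
        intro c d hcd hc
        have hf : ∀ x, f x = c ∨ f x = d := fun x => by
          have := Finset.mem_image_of_mem f (Finset.mem_univ x)
          rwa [hc, Finset.mem_insert, Finset.mem_singleton] at this
        obtain ⟨x, -, hx⟩ := Finset.mem_image.1 (hc ▸ Finset.mem_insert_self c {d})
        obtain ⟨y, -, hy⟩ := Finset.mem_image.1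
          (hc ▸ Finset.mem_insert_of_mem (Finset.mem_singleton_self d))
        refine ⟨.inr (.inr (⟨(c, d), hcd⟩, ⟨fun z => if f z = c then 0 else 1, fun i => ?_⟩)),
          funext fun z => ?_⟩
        · fin_cases i
          · exact ⟨x, by simp [hx]⟩
          · exact ⟨y, by simp [hy, hcd.ne']⟩
        · rcases hf z with h | h
          · simp [spread, h]
          · simp [spread, h, hcd.ne']
      obtain ⟨c, d, hne, hcd⟩ := Finset.card_eq_two.1 hc
      rcases lt_or_gt_of_ne hne with h | h
      · exact key c d h hcd
      · exact key d c h (by rw [hcd, Finset.pair_comm])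

/-! ### Decomposition of the weight of a world -/

variable {r m : ℕ} {ar : Fin r → ℕ}

/-- Atoms whose arguments are exactly `0, …, k - 1`. -/
abbrev SAtom (ar : Fin r → ℕ) (k : ℕ) : Type := Σ p : Fin r, Onto (Fin (ar p)) k

/-- Ground atoms with at most two distinct arguments. -/
abbrev Cell (ar : Fin r → ℕ) (n : ℕ) : Type :=
  SAtom ar 0 ⊕ (Fin n × SAtom ar 1) ⊕ (Pairs n × SAtom ar 2)

instance (k : ℕ) : DecidableEq (SAtom ar k) := inferInstance

instance (n : ℕ) : DecidableEq (Pairs n) := inferInstance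

def place {n : ℕ} : Cell ar n → GroundAtom ar n
  | .inl a => ⟨a.1, spread (.inl a.2)⟩
  | .inr (.inl (c, a)) => ⟨a.1, spread (.inr (.inl (c, a.2)))⟩
  | .inr (.inr (cd, a)) => ⟨a.1, spread (.inr (.inr (cd, a.2)))⟩

theorem place_injective {n : ℕ} : Function.Injective (place (ar := ar) (n := n)) := by
  have h : ∀ p : Fin r, Function.Injective (spread (v := Fin (ar p)) (n := n)) :=
    fun _ => spread_injective
  rintro (⟨p, σ⟩ | ⟨c, p, σ⟩ | ⟨cd, p, σ⟩) (⟨p', σ'⟩ | ⟨c', p', σ'⟩ | ⟨cd', p', σ'⟩) he <;>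
  · obtain ⟨rfl, he'⟩ := Sigma.mk.inj_iff.1 he
    have := h p (eq_of_heq he')
    simp_all

theorem mem_range_place {n : ℕ} {a : GroundAtom ar n} :
    a ∈ Set.range place ↔ a.width ≤ 2 := by
  obtain ⟨p, f⟩ := a
  change _ ↔ (Finset.univ.image f).card ≤ 2
  rw [← mem_range_spread]
  constructor
  · rintro ⟨⟨p', σ⟩ | ⟨c, p', σ⟩ | ⟨cd, p', σ⟩, he⟩ <;>
    · obtain ⟨rfl, he'⟩ := Sigma.mk.inj_iff.1 he
      exact ⟨_, eq_of_heq he'⟩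
  · rintro ⟨σ | ⟨c, σ⟩ | ⟨cd, σ⟩, rfl⟩
    · exact ⟨.inl ⟨p, σ⟩, rfl⟩
    · exact ⟨.inr (.inl (c, ⟨p, σ⟩)), rfl⟩
    · exact ⟨.inr (.inr (cd, ⟨p, σ⟩)), rfl⟩

/-- The world seen through a map between domains. -/
def pull {k n : ℕ} (g : Fin k → Fin n) (ω : GroundAtom ar n → Bool) : GroundAtom ar k → Bool :=
  fun a => ω ⟨a.1, fun i => g (a.2 i)⟩

/-- This moves a grounding over constants in the range of `g` to the abstract domain `Fin k`. -/
theorem Formula.eval_pull {k n : ℕ} (g : Fin k → Fin n) (ω : GroundAtom ar n → Bool)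
    (f : Formula ar) (σ : f.vars → Fin k) :
    f.eval ω (fun x => g (σ x)) = f.eval (pull g ω) σ := by
  induction f with
  | atom a => rfl
  | neg f ih => simp only [Formula.eval]; rw [← ih σ]; rfl
  | and f g' ihf ihg => simp only [Formula.eval]; rw [← ihf, ← ihg]
  | or f g' ihf ihg => simp only [Formula.eval]; rw [← ihf, ← ihg]
  | imp f g' ihf ihg => simp only [Formula.eval]; rw [← ihf, ← ihg]
  | iff f g' ihf ihg => simp only [Formula.eval]; rw [← ihf, ← ihg]

/-- The product of the weights of all satisfied groundings that use all of the `k` constants. -/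
def localWeight (F : Fin m → Formula ar) (W : Fin m → ℝ) (k : ℕ) (ω : GroundAtom ar k → Bool) : ℝ :=
  ∏ i, ∏ σ : Onto (F i).vars k, if (F i).eval ω σ.1 then W i else 1

/-- With two variables, each grounding is in exactly one way a surjection onto zero, one or two
abstract constants followed by an increasing choice of actual ones. The factors arise by grouping
groundings according to this choice. -/
theorem worldWeight_eq (F : Fin m → Formula ar) (hF : ∀ i, (F i).vars.card ≤ 2) (w : Fin m → ℝ)
    {n : ℕ} (ω : GroundAtom ar n → Bool) :
    worldWeight F w ω = localWeight F (fun i => Real.exp (w i)) 0 (pull Fin.elim0 ω) *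
      ((∏ c, localWeight F (fun i => Real.exp (w i)) 1 (pull ![c] ω)) *
        ∏ cd : Pairs n, localWeight F (fun i => Real.exp (w i)) 2 (pull ![cd.1.1, cd.1.2] ω)) := by
  unfold worldWeight localWeight
  rw [Finset.prod_comm (s := (Finset.univ : Finset (Fin n))),
    Finset.prod_comm (s := (Finset.univ : Finset (Pairs n))), ← Finset.prod_mul_distrib,
    ← Finset.prod_mul_distrib]
  refine Finset.prod_congr rfl fun i _ => ?_
  have hsurj : Function.Bijective (spread (v := (F i).vars) (n := n)) := by
    refine ⟨spread_injective, fun f => mem_range_spread.2 ?_⟩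
    exact Finset.card_image_le.trans (by simpa using hF i)
  rw [← hsurj.prod_comp, Fintype.prod_sum_type, Fintype.prod_sum_type, Fintype.prod_prod_type,
    Fintype.prod_prod_type]
  simp only [← Formula.eval_pull]
  rfl

/-! ### Factorization of sums over worlds -/

def cellWorld {n : ℕ} (ν : SAtom ar 0 → Bool) (τ : Fin n → SAtom ar 1 → Bool)
    (t : Pairs n → SAtom ar 2 → Bool) : Cell ar n → Bool
  | .inl a => ν a
  | .inr (.inl (c, a)) => τ c a
  | .inr (.inr (cd, a)) => t cd a

def cellWorldEquiv (ar : Fin r → ℕ) (n : ℕ) :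
    (SAtom ar 0 → Bool) × (Fin n → SAtom ar 1 → Bool) × (Pairs n → SAtom ar 2 → Bool) ≃
      (Cell ar n → Bool) where
  toFun x := cellWorld x.1 x.2.1 x.2.2
  invFun f := (fun a => f (.inl a), fun c a => f (.inr (.inl (c, a))),
    fun cd a => f (.inr (.inr (cd, a))))
  left_inv _ := rfl
  right_inv f := by
    funext x
    rcases x with a | ⟨c, a⟩ | ⟨cd, a⟩ <;> rfl

/-- The weight of the groundings that use all of `k` constants, where `ν`, `τ`, `t` describe the
world on these constants. -/
def cellWeight (F : Fin m → Formula ar) (W : Fin m → ℝ) (k : ℕ) (ν : SAtom ar 0 → Bool)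
    (τ : Fin k → SAtom ar 1 → Bool) (t : SAtom ar 2 → Bool) : ℝ :=
  localWeight F W k (Function.extend place (cellWorld ν τ fun _ => t) fun _ => false)

/-- Over at most two constants every atom comes from a cell, so the default `false` is never
reached. Monotonicity of `g` keeps pairs in increasing order. -/
theorem pull_eq_extend {k n : ℕ} (hk : k ≤ 2) {g : Fin k → Fin n} (hg : StrictMono g)
    {ω : GroundAtom ar n → Bool} {ν : SAtom ar 0 → Bool} {τ : Fin n → SAtom ar 1 → Bool}
    {t : Pairs n → SAtom ar 2 → Bool} (hω : ∀ x, ω (place x) = cellWorld ν τ t x)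
    {τ' : Fin k → SAtom ar 1 → Bool} (hτ : ∀ i, τ' i = τ (g i))
    {t' : SAtom ar 2 → Bool}
    (ht : ∀ i j : Fin k, ∀ h : i < j, t' = t ⟨(g i, g j), hg h⟩) :
    pull g ω = Function.extend place (cellWorld ν τ' fun _ => t') fun _ => false := by
  funext a
  obtain ⟨x, rfl⟩ : a ∈ Set.range place :=
    mem_range_place.2 ((Finset.card_le_univ _).trans (by simpa using hk))
  rw [place_injective.extend_apply]
  rcases x with a | ⟨c, a⟩ | ⟨⟨⟨c, d⟩, hcd⟩, a⟩
  · rw [show cellWorld ν τ' (fun _ => t') (.inl a) = cellWorld ν τ t (.inl a) from rfl, ← hω]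
    simp only [pull, place]
    congr 2
    funext i
    exact (a.2.1 i).elim0
  · rw [show cellWorld ν τ' (fun _ => t') (.inr (.inl (c, a))) =
      cellWorld ν τ t (.inr (.inl (g c, a))) from congrFun (hτ c) a, ← hω]
    simp only [pull, place]
    congr 2
    funext i
    simp [spread]
  · rw [show cellWorld ν τ' (fun _ => t') (.inr (.inr (⟨(c, d), hcd⟩, a))) =
      cellWorld ν τ t (.inr (.inr (⟨(g c, g d), hg hcd⟩, a))) from congrFun (ht c d hcd) a, ← hω]
    simp only [pull, place]
    congr 2
    funext i
    simp only [spread]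
    generalize a.2.1 i = j
    fin_cases j <;> rfl

theorem worldWeight_cellWorld (F : Fin m → Formula ar) (hF : ∀ i, (F i).vars.card ≤ 2)
    (w : Fin m → ℝ) {n : ℕ} {ω : GroundAtom ar n → Bool} {ν : SAtom ar 0 → Bool}
    {τ : Fin n → SAtom ar 1 → Bool} {t : Pairs n → SAtom ar 2 → Bool}
    (hω : ∀ x, ω (place x) = cellWorld ν τ t x) :
    worldWeight F w ω =
      cellWeight F (fun i => Real.exp (w i)) 0 ν (fun _ _ => false) (fun _ => false) *
      ((∏ c, cellWeight F (fun i => Real.exp (w i)) 1 ν ![τ c] (fun _ => false)) *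
        ∏ cd : Pairs n,
          cellWeight F (fun i => Real.exp (w i)) 2 ν ![τ cd.1.1, τ cd.1.2] (t cd)) := by
  have h0 : pull Fin.elim0 ω = Function.extend place
      (cellWorld ν (fun _ _ => false) fun _ _ => false) fun _ => false :=
    pull_eq_extend (by omega) (Subsingleton.strictMono _) hω (fun i => i.elim0) (fun i => i.elim0)
  have h1 : ∀ c, pull ![c] ω = Function.extend place
      (cellWorld ν ![τ c] fun _ _ => false) fun _ => false := fun c =>
    pull_eq_extend (by omega) (Subsingleton.strictMono _) hω (fun i => by simp)
      (fun i j h => by omega)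
  have h2 : ∀ cd : Pairs n, pull ![cd.1.1, cd.1.2] ω = Function.extend place
      (cellWorld ν ![τ cd.1.1, τ cd.1.2] fun _ => t cd) fun _ => false := fun cd => by
    have hg : StrictMono ![cd.1.1, cd.1.2] := by
      intro i j hij
      fin_cases i <;> fin_cases j <;> first | exact cd.2 | exact absurd hij (by decide)
    refine pull_eq_extend le_rfl hg hω (fun i => by fin_cases i <;> rfl) fun i j h => ?_
    fin_cases i <;> fin_cases j <;> first | rfl | exact absurd h (by decide)
  simp only [worldWeight_eq F hF, h0, h1, h2, cellWeight]

theorem sum_arrow_equiv {A B D : Type} [Fintype A] [Fintype B] [Fintype D] [DecidableEq A]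
    [DecidableEq B] [DecidableEq D] (e : A ⊕ B ≃ D) (G : (D → Bool) → ℝ) :
    ∑ ω, G ω = ∑ f : A → Bool, ∑ g : B → Bool, G (fun a => Sum.elim f g (e.symm a)) := by
  rw [← (Equiv.arrowCongr e (Equiv.refl Bool)).sum_comp,
    ← (Equiv.sumArrowEquivProdArrow _ _ _).symm.sum_comp, Fintype.sum_prod_type]
  rfl

/-- The weighted sum over all worlds factorizes over the constants and pairs of constants. -/
theorem sum_worldWeight (F : Fin m → Formula ar) (hF : ∀ i, (F i).vars.card ≤ 2) (w : Fin m → ℝ)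
    {n : ℕ} (ε : GroundAtom ar n → Bool → ℝ) :
    ∑ ω : GroundAtom ar n → Bool, worldWeight F w ω * ∏ a, ε a (ω a) =
      (∑ ν : SAtom ar 0 → Bool, ((∏ a, ε (place (.inl a)) (ν a)) *
        cellWeight F (fun i => Real.exp (w i)) 0 ν (fun _ _ => false) (fun _ => false)) *
        ∑ τ : Fin n → SAtom ar 1 → Bool,
          (∏ c, (cellWeight F (fun i => Real.exp (w i)) 1 ν ![τ c] (fun _ => false) *
            ∏ a, ε (place (.inr (.inl (c, a)))) (τ c a))) *
          ∏ cd : Pairs n, ∑ t : SAtom ar 2 → Bool,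
            cellWeight F (fun i => Real.exp (w i)) 2 ν ![τ cd.1.1, τ cd.1.2] t *
              ∏ a, ε (place (.inr (.inr (cd, a)))) (t a)) *
      ∏ a : {a : GroundAtom ar n // 2 < a.width}, ∑ b, ε a.1 b := by
  have hbij : Function.Bijective (Sum.elim (place (ar := ar) (n := n))
      (Subtype.val : {a : GroundAtom ar n // 2 < a.width} → _)) := by
    constructor
    · refine place_injective.sumElim Subtype.val_injective fun x a h =>
        (mem_range_place.1 ⟨x, h⟩).not_gt a.2
    · intro a
      by_cases h : a ∈ Set.range place
      · obtain ⟨x, rfl⟩ := h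
        exact ⟨.inl x, rfl⟩
      · exact ⟨.inr ⟨a, by rwa [mem_range_place, not_le] at h⟩, rfl⟩
  set e := Equiv.ofBijective _ hbij with he
  have hsum : ∀ G : (GroundAtom ar n → Bool) → ℝ, ∑ ω, G ω = ∑ f : Cell ar n → Bool,
      ∑ g : {a : GroundAtom ar n // 2 < a.width} → Bool,
        G (fun a => Sum.elim f g (e.symm a)) := sum_arrow_equiv e
  have hel : ∀ x, e.symm (place x) = .inl x := fun x => by
    rw [Equiv.symm_apply_eq]; rfl
  have her : ∀ a : {a : GroundAtom ar n // 2 < a.width}, e.symm a.1 = .inr a := fun a => by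
    rw [Equiv.symm_apply_eq]; rfl
  have hterm : ∀ (ν : SAtom ar 0 → Bool) (τ : Fin n → SAtom ar 1 → Bool)
      (t : Pairs n → SAtom ar 2 → Bool) (g : {a : GroundAtom ar n // 2 < a.width} → Bool),
      worldWeight F w (fun a => Sum.elim (cellWorld ν τ t) g (e.symm a)) *
        ∏ a, ε a (Sum.elim (cellWorld ν τ t) g (e.symm a)) =
      ((∏ a, ε (place (.inl a)) (ν a)) *
        cellWeight F (fun i => Real.exp (w i)) 0 ν (fun _ _ => false) (fun _ => false)) *
      ((∏ c, (cellWeight F (fun i => Real.exp (w i)) 1 ν ![τ c] (fun _ => false) *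
            ∏ a, ε (place (.inr (.inl (c, a)))) (τ c a))) *
        ∏ cd : Pairs n, (cellWeight F (fun i => Real.exp (w i)) 2 ν ![τ cd.1.1, τ cd.1.2] (t cd) *
              ∏ a, ε (place (.inr (.inr (cd, a)))) (t cd a))) *
      ∏ a : {a : GroundAtom ar n // 2 < a.width}, ε a.1 (g a) := by
    intro ν τ t g
    rw [← hbij.prod_comp, Fintype.prod_sum_type, Fintype.prod_sum_type, Fintype.prod_sum_type,
      Fintype.prod_prod_type, Fintype.prod_prod_type,
      worldWeight_cellWorld F hF w (ν := ν) (τ := τ) (t := t)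
        fun x => by simp only [hel, Sum.elim_inl]]
    simp only [Sum.elim_inl, Sum.elim_inr, hel, her, Finset.prod_mul_distrib, cellWorld]
    ring
  -- Distributivity: once `ν` and `τ` are fixed, the tables of different pairs are summed
  -- independently.
  have hprod : ∀ τ : Fin n → SAtom ar 1 → Bool, ∀ ν : SAtom ar 0 → Bool,
      ∏ cd : Pairs n, ∑ t : SAtom ar 2 → Bool,
        cellWeight F (fun i => Real.exp (w i)) 2 ν ![τ cd.1.1, τ cd.1.2] t *
          ∏ a, ε (place (.inr (.inr (cd, a)))) (t a) =
      ∑ t : Pairs n → SAtom ar 2 → Bool, ∏ cd : Pairs n,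
        (cellWeight F (fun i => Real.exp (w i)) 2 ν ![τ cd.1.1, τ cd.1.2] (t cd) *
          ∏ a, ε (place (.inr (.inr (cd, a)))) (t cd a)) := fun τ ν => by
    rw [Finset.prod_univ_sum, Fintype.piFinset_univ]
  have hP : ∏ a : {a : GroundAtom ar n // 2 < a.width}, ∑ b, ε a.1 b =
      ∑ g : {a : GroundAtom ar n // 2 < a.width} → Bool, ∏ a, ε a.1 (g a) := by
    rw [Finset.prod_univ_sum, Fintype.piFinset_univ]
  generalize ∏ a : {a : GroundAtom ar n // 2 < a.width}, ∑ b, ε a.1 b = P at hP ⊢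
  rw [hsum, ← (cellWorldEquiv ar n).sum_comp, Fintype.sum_prod_type, Finset.sum_mul]
  refine Finset.sum_congr rfl fun ν _ => ?_
  rw [Fintype.sum_prod_type, Finset.mul_sum, Finset.sum_mul]
  refine Finset.sum_congr rfl fun τ _ => ?_
  rw [hprod, Finset.mul_sum, Finset.mul_sum, Finset.sum_mul]
  refine Finset.sum_congr rfl fun t _ => ?_
  rw [hP, Finset.mul_sum]
  exact Finset.sum_congr rfl fun g _ => hterm ν τ t g

end

end MarkovLogic

namespace MarkovLogic

noncomputable section

/-! ### Types with slots -/

/-- The first index, in some fixed enumeration, at which `f` takes the value `c`. -/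
def IsFirst {ι : Type} [Fintype ι] (f : ι → ℕ) (c : ℕ) (s : ι) : Prop :=
  f s = c ∧ ∀ s', Fintype.equivFin ι s' < Fintype.equivFin ι s → f s' ≠ c

-- A constant may occupy several slots; choosing the first gives it one definite label.
open Classical in
def findIndex {ι : Type} [Fintype ι] (f : ι → ℕ) (c : ℕ) : Option ι :=
  if h : ∃ s, IsFirst f c s then some h.choose else none

theorem findIndex_eq_some {ι : Type} [Fintype ι] {f : ι → ℕ} {c : ℕ} {s : ι} :
    findIndex f c = some s ↔ IsFirst f c s := by
  have huniq : ∀ s s', IsFirst f c s → IsFirst f c s' → s = s' := by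
    intro s s' h h'
    rcases lt_trichotomy (Fintype.equivFin ι s) (Fintype.equivFin ι s') with hlt | he | hlt
    · exact absurd h.1 (h'.2 s hlt)
    · exact (Fintype.equivFin ι).injective he
    · exact absurd h'.1 (h.2 s' hlt)
  unfold findIndex
  split_ifs with h
  · rw [Option.some_inj]
    exact ⟨fun h' => h' ▸ h.choose_spec, fun h' => huniq _ _ h.choose_spec h'⟩
  · simp only [false_iff]
    exact fun h' => h ⟨s, h'⟩

theorem findIndex_eq_none {ι : Type} [Fintype ι] {f : ι → ℕ} {c : ℕ} :
    findIndex f c = none ↔ ∀ s, f s ≠ c := by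
  constructor
  · intro h s hs
    obtain ⟨s₀, hs₀, hmin⟩ := (InvImage.wf (Fintype.equivFin ι) wellFounded_lt).has_min
      {s | f s = c} ⟨s, hs⟩
    have : findIndex f c = some s₀ := findIndex_eq_some.2 ⟨hs₀, fun s' hlt he => hmin s' he hlt⟩
    rw [h] at this
    exact absurd this (by simp)
  · intro h
    cases hc : findIndex f c with
    | none => rfl
    | some s => exact absurd (findIndex_eq_some.1 hc).1 (h s)

theorem prod_pairs {n : ℕ} (f : Fin n → Fin n → ℝ) :
    (∏ d : Fin n, ∏ c : Fin n, if c < d then f c d else 1) = ∏ cd : Pairs n, f cd.1.1 cd.1.2 := by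
  rw [Finset.prod_comm, ← Fintype.prod_prod_type', ← Finset.prod_filter]
  exact Finset.prod_subtype _ (by simp) _

/-- When each position carries the additional label `sl c`, the weights of pairs may depend on
the positions through their labels. -/
theorem sum_seqWeight_label {U O : Type} [Fintype U] [Fintype O] [DecidableEq O]
    {n : ℕ} (sl : ℕ → O) (α : ℕ → U → ℝ) (ρ : ℕ → ℕ → U → U → ℝ) (ρ' : U × O → U × O → ℝ)
    (h : ∀ c d u v, c < d → d < n → ρ' (u, sl c) (v, sl d) = ρ c d u v) :
    ∑ τ : Fin n → U × O, seqWeight (fun c t => if sl c = t.2 then α c t.1 else 0) ρ' τ =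
      ∑ τ : Fin n → U, (∏ c : Fin n, α c (τ c)) *
        ∏ cd : Pairs n, ρ cd.1.1 cd.1.2 (τ cd.1.1) (τ cd.1.2) := by
  classical
  simp only [seqWeight, Finset.prod_mul_distrib]
  rw [← (Equiv.arrowProdEquivProdArrow (Fin n) (fun _ => U) (fun _ => O)).symm.sum_comp,
    Fintype.sum_prod_type]
  refine Finset.sum_congr rfl fun τ _ => ?_
  -- Any labelling other than the prescribed one has a position of weight zero.
  rw [Fintype.sum_eq_single (fun c : Fin n => sl c)]
  · simp only [Equiv.arrowProdEquivProdArrow, Equiv.coe_fn_symm_mk, if_true]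
    rw [prod_pairs fun c d => ρ' (τ c, sl c) (τ d, sl d)]
    congr 1
    exact Finset.prod_congr rfl fun cd _ => h _ _ _ _ cd.2 cd.1.2.2
  · intro κ hκ
    obtain ⟨c, hc⟩ := Function.ne_iff.1 hκ
    rw [Finset.prod_eq_zero (Finset.mem_univ c), zero_mul]
    exact if_neg (Ne.symm hc)

/-! ### Inference problems as data of natural and real numbers -/

/-- The numbers that describe an inference problem: the domain size, the number of listed atoms,
the weights, and the predicates, evidence and arguments of the listed atoms. -/
structure Data : Type where
  n : ℕ
  q : ℕ
  W : ℕ → ℝ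
  pd : ℕ → ℕ
  ev : ℕ → ℕ
  arg : ℕ → ℕ → ℕ

variable {r m : ℕ} {ar : Fin r → ℕ}

/-- The numbers in `d` describe weights `w`, listed atoms `V` and evidence `e`. -/
structure Encodes {n q : ℕ} (d : Data) (w : Fin m → ℝ) (V : Fin q → GroundAtom ar n)
    (e : Fin q → Option Bool) : Prop where
  n_eq : d.n = n
  q_eq : d.q = q
  W : ∀ i : Fin m, d.W i = Real.exp (w i)
  pd : ∀ i : Fin q, d.pd i = (V i).1
  arg : ∀ (i : Fin q) (j : Fin (ar (V i).1)), d.arg j i = (V i).2 j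
  ev : ∀ i : Fin q, d.ev i = encodeEvidence (e i)

/-- The `i`-th listed atom is `p(g 0, g 1, …)`. -/
def IsAt (d : Data) (i : ℕ) (p : Fin r) (g : Fin (ar p) → ℕ) : Prop :=
  d.pd i = p ∧ ∀ j : Fin (ar p), d.arg j i = g j

/-- The `i`-th listed atom has two distinct arguments. -/
def IsWide (ar : Fin r → ℕ) (d : Data) (i : ℕ) : Prop :=
  ∃ p : Fin r, d.pd i = p ∧ ∃ j j' : Fin (ar p), d.arg j i ≠ d.arg j' i

/-- The `i`-th listed atom has three distinct arguments. -/
def IsVeryWide (ar : Fin r → ℕ) (d : Data) (i : ℕ) : Prop :=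
  ∃ p : Fin r, d.pd i = p ∧ ∃ j j' j'' : Fin (ar p), d.arg j i ≠ d.arg j' i ∧
    d.arg j i ≠ d.arg j'' i ∧ d.arg j' i ≠ d.arg j'' i

open Classical in
/-- `0` if the evidence contradicts the value `x` of the atom `p(g 0, g 1, …)`, and `1` else. -/
def evFactor (d : Data) (p : Fin r) (g : Fin (ar p) → ℕ) (x : Bool) : ℝ :=
  ∏ i ∈ Finset.range d.q, if IsAt d i p g ∧ d.ev i = (!x).toNat then 0 else 1

open Classical in
/-- The number of wide atoms listed before the `i`-th atom. -/
def wideRank (ar : Fin r → ℕ) (d : Data) (i : ℕ) : ℕ :=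
  ((Finset.range i).filter (IsWide ar d)).card

/-- Positions of arguments in at most `b` atoms. -/
abbrev Slot (ar : Fin r → ℕ) (b : ℕ) : Type := Fin b × Fin (∑ p, ar p)

open Classical in
/-- The constant at a position in the list of all wide atoms. -/
def slotElt {b : ℕ} (d : Data) (s : Slot ar b) : ℕ :=
  ∑ i ∈ Finset.range d.q, if IsWide ar d i ∧ wideRank ar d i = s.1 then d.arg s.2 i else 0

/-- Unused slots may name a constant that is in no wide atom. This is harmless: it matters only that
all arguments of wide atoms have slots and that a slot determines its constant. -/
def slotOf (ar : Fin r → ℕ) (b : ℕ) (d : Data) (c : ℕ) : Option (Slot ar b) :=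
  findIndex (slotElt d) c

/-! ### Atoms, evidence and slots of an encoded problem -/

section Encoded

variable {n q : ℕ} {d : Data} {w : Fin m → ℝ} {V : Fin q → GroundAtom ar n}
  {e : Fin q → Option Bool}

theorem Encodes.isAt_iff (h : Encodes d w V e) (i : Fin q) (a : GroundAtom ar n) :
    IsAt d i a.1 (fun j => (a.2 j : ℕ)) ↔ V i = a := by
  have harg := h.arg i
  unfold IsAt
  rw [h.pd]
  generalize V i = a' at harg ⊢
  obtain ⟨p, g⟩ := a
  obtain ⟨p', g'⟩ := a'
  simp only at harg ⊢
  constructor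
  · rintro ⟨hp, hj⟩
    obtain rfl : p' = p := Fin.ext hp
    congr 1
    funext j
    exact Fin.ext ((harg j).symm.trans (hj j))
  · intro he
    obtain ⟨rfl, he'⟩ := Sigma.mk.inj_iff.1 he
    obtain rfl := eq_of_heq he'
    exact ⟨rfl, harg⟩

theorem encodeEvidence_eq_toNat (o : Option Bool) (x : Bool) :
    encodeEvidence o = x.toNat ↔ o = some x := by
  rcases o with _ | _ | _ <;> cases x <;> simp [encodeEvidence]

theorem encodeEvidence_eq_two (o : Option Bool) : encodeEvidence o = 2 ↔ o = none := by
  rcases o with _ | _ | _ <;> simp [encodeEvidence]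

open Classical in
theorem Encodes.evFactor_eq (h : Encodes d w V e) (a : GroundAtom ar n) (x : Bool) :
    evFactor d a.1 (fun j => (a.2 j : ℕ)) x =
      if ∃ i, V i = a ∧ e i = some (!x) then 0 else 1 := by
  rw [evFactor, h.q_eq, Finset.prod_range]
  simp only [h.isAt_iff, h.ev, encodeEvidence_eq_toNat]
  split_ifs with hex
  · obtain ⟨i, hi⟩ := hex
    exact Finset.prod_eq_zero (Finset.mem_univ i) (if_pos hi)
  · exact Finset.prod_eq_one fun i _ => if_neg fun hi => hex ⟨i, hi⟩

theorem Encodes.isWide_iff (h : Encodes d w V e) (i : Fin q) :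
    IsWide ar d i ↔ 1 < (V i).width := by
  have harg := h.arg i
  unfold IsWide Atom.width
  rw [h.pd, Finset.one_lt_card]
  constructor
  · rintro ⟨p, hp, j, j', hj⟩
    obtain rfl : (V i).1 = p := Fin.ext hp
    rw [harg, harg] at hj
    exact ⟨_, Finset.mem_image_of_mem _ (Finset.mem_univ j), _,
      Finset.mem_image_of_mem _ (Finset.mem_univ j'), fun he => hj (congrArg Fin.val he)⟩
  · rintro ⟨x, hx, y, hy, hxy⟩
    obtain ⟨j, -, rfl⟩ := Finset.mem_image.1 hx
    obtain ⟨j', -, rfl⟩ := Finset.mem_image.1 hy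
    exact ⟨_, rfl, j, j', by rw [harg, harg]; exact fun he => hxy (Fin.ext he)⟩

theorem Encodes.isVeryWide_iff (h : Encodes d w V e) (i : Fin q) :
    IsVeryWide ar d i ↔ 2 < (V i).width := by
  have harg := h.arg i
  unfold IsVeryWide Atom.width
  rw [h.pd, Finset.two_lt_card]
  constructor
  · rintro ⟨p, hp, j, j', j'', h1, h2, h3⟩
    obtain rfl : (V i).1 = p := Fin.ext hp
    rw [harg, harg] at h1 h2 h3
    exact ⟨_, Finset.mem_image_of_mem _ (Finset.mem_univ j), _,
      Finset.mem_image_of_mem _ (Finset.mem_univ j'), _,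
      Finset.mem_image_of_mem _ (Finset.mem_univ j''), fun he => h1 (congrArg Fin.val he),
      fun he => h2 (congrArg Fin.val he), fun he => h3 (congrArg Fin.val he)⟩
  · rintro ⟨x, hx, y, hy, z, hz, hxy, hxz, hyz⟩
    obtain ⟨j, -, rfl⟩ := Finset.mem_image.1 hx
    obtain ⟨j', -, rfl⟩ := Finset.mem_image.1 hy
    obtain ⟨j'', -, rfl⟩ := Finset.mem_image.1 hz
    refine ⟨_, rfl, j, j', j'', ?_⟩
    simp only [harg]
    exact ⟨fun he => hxy (Fin.ext he), fun he => hxz (Fin.ext he), fun he => hyz (Fin.ext he)⟩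

theorem Encodes.wideRank_lt (h : Encodes d w V e) {b : ℕ}
    (hb : (Finset.univ.filter fun i => 1 < (V i).width).card ≤ b) {i : Fin q}
    (hi : 1 < (V i).width) : wideRank ar d i < b := by
  classical
  refine lt_of_lt_of_le ?_ hb
  unfold wideRank
  have hsub : ((Finset.range i).filter (IsWide ar d)).card ≤
      ((Finset.univ.filter fun i => 1 < (V i).width).erase i).card := by
    refine (Finset.card_le_card ?_).trans_eq
      (Finset.card_image_of_injective _ (Fin.val_injective (n := q)))
    intro k hk
    obtain ⟨hk, hw⟩ := Finset.mem_filter.1 hk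
    have hki := Finset.mem_range.1 hk
    refine Finset.mem_image.2 ⟨⟨k, hki.trans i.2⟩, ?_, rfl⟩
    rw [Finset.mem_erase, Finset.mem_filter]
    exact ⟨fun he => hki.ne (congrArg Fin.val he), Finset.mem_univ _,
      (h.isWide_iff ⟨k, hki.trans i.2⟩).1 hw⟩
  exact hsub.trans_lt (Finset.card_erase_lt_of_mem (by simpa using hi))

/-- The later count includes `i` itself. Hence wide atoms are told apart by their ranks. -/
theorem wideRank_lt_of_lt {d : Data} {i i' : ℕ} (hi : IsWide ar d i) (hlt : i < i') :
    wideRank ar d i < wideRank ar d i' := by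
  classical
  refine Finset.card_lt_card (Finset.ssubset_iff_of_subset ?_ |>.2 ⟨i, ?_, ?_⟩)
  · exact Finset.filter_subset_filter _ (Finset.range_subset_range.2 hlt.le)
  · simp [hlt, hi]
  · simp

/-- All arguments of wide atoms are found in slots. -/
theorem Encodes.exists_slotElt (h : Encodes d w V e) {b : ℕ}
    (hb : (Finset.univ.filter fun i => 1 < (V i).width).card ≤ b) {i : Fin q}
    (hi : 1 < (V i).width) (j : Fin (ar (V i).1)) :
    ∃ s : Slot ar b, slotElt d s = (V i).2 j := by
  classical
  have hj : (j : ℕ) < ∑ p, ar p :=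
    j.2.trans_le (Finset.single_le_sum (f := ar) (fun _ _ => Nat.zero_le _) (Finset.mem_univ _))
  refine ⟨(⟨wideRank ar d i, h.wideRank_lt hb hi⟩, ⟨j, hj⟩), ?_⟩
  have hw := (h.isWide_iff i).2 hi
  rw [slotElt, Finset.sum_eq_single (i : ℕ)]
  · simp only [hw, true_and, if_true, h.arg]
  · intro k _ hk
    refine if_neg ?_
    rintro ⟨hkw, hr⟩
    rcases lt_or_gt_of_ne hk with hlt | hlt
    · exact (wideRank_lt_of_lt hkw hlt).ne hr
    · exact (wideRank_lt_of_lt hw hlt).ne hr.symm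
  · intro hn
    exact absurd (Finset.mem_range.2 (h.q_eq ▸ i.2)) hn

theorem slotElt_of_slotOf {b c : ℕ} {d : Data} {s : Slot ar b} (h : slotOf ar b d c = some s) :
    slotElt d s = c := (findIndex_eq_some.1 h).1

theorem Encodes.slotOf_ne_none (h : Encodes d w V e) {b : ℕ}
    (hb : (Finset.univ.filter fun i => 1 < (V i).width).card ≤ b) {i : Fin q}
    (hi : 1 < (V i).width) (j : Fin (ar (V i).1)) :
    slotOf ar b d ((V i).2 j) ≠ none := by
  obtain ⟨s, hs⟩ := h.exists_slotElt hb hi j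
  exact fun h0 => findIndex_eq_none.1 h0 s hs

end Encoded

end

end MarkovLogic

namespace MarkovLogic

noncomputable section

variable {r m : ℕ} {ar : Fin r → ℕ}

/-! ### The lifted formula for probabilities -/

/-- The weight of a constant `c` whose unary atoms are described by `u`. -/
def unaryWeight (F : Fin m → Formula ar) (d : Data) (ν : SAtom ar 0 → Bool) (c : ℕ)
    (u : SAtom ar 1 → Bool) : ℝ :=
  cellWeight F (fun i => d.W i) 1 ν ![u] (fun _ => false) *
    ∏ a : SAtom ar 1, evFactor (ar := ar) d a.1 (fun _ => c) (u a)

/-- The weight of a pair of constants, whose binary atoms are summed out. -/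
def pairWeight (F : Fin m → Formula ar) (d : Data) (ν : SAtom ar 0 → Bool) (c c' : ℕ)
    (u v : SAtom ar 1 → Bool) : ℝ :=
  ∑ t : SAtom ar 2 → Bool, cellWeight F (fun i => d.W i) 2 ν ![u, v] t *
    ∏ a : SAtom ar 2, evFactor (ar := ar) d a.1 (fun j => ![c, c'] (a.2.1 j)) (t a)

def freePairWeight (F : Fin m → Formula ar) (d : Data) (ν : SAtom ar 0 → Bool)
    (u v : SAtom ar 1 → Bool) : ℝ :=
  ∑ t : SAtom ar 2 → Bool, cellWeight F (fun i => d.W i) 2 ν ![u, v] t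

/-- A wrong slot has weight zero, so only sequences of types that carry the true slots contribute.
-/
def typeWeight (b : ℕ) (F : Fin m → Formula ar) (d : Data) (ν : SAtom ar 0 → Bool) (c : ℕ)
    (t : (SAtom ar 1 → Bool) × Option (Slot ar b)) : ℝ :=
  if slotOf ar b d c = t.2 then unaryWeight F d ν c t.1 else 0

/-- Two slots recover both constants and thereby the evidence on the pair; if a slot is missing, no
listed atom has exactly this pair as arguments. -/
def typePairWeight (b : ℕ) (F : Fin m → Formula ar) (d : Data) (ν : SAtom ar 0 → Bool)
    (t t' : (SAtom ar 1 → Bool) × Option (Slot ar b)) : ℝ :=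
  match t.2, t'.2 with
  | some s, some s' => pairWeight F d ν (slotElt d s) (slotElt d s') t.1 t'.1
  | _, _ => freePairWeight F d ν t.1 t'.1

/-- The total weight of the worlds that agree with the evidence, restricted to ground atoms with
at most two distinct arguments. -/
def liftedSum (b : ℕ) (F : Fin m → Formula ar) (d : Data) : ℝ :=
  ∑ ν : SAtom ar 0 → Bool, ((∏ a : SAtom ar 0, evFactor (ar := ar) d a.1 (fun _ => 0) (ν a)) *
    cellWeight F (fun i => d.W i) 0 ν (fun _ _ => false) (fun _ => false)) *
    restWeight d.n (typeWeight b F d ν) (typePairWeight b F d ν) d.n (fun _ => 0)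

open Classical in
/-- The probability of the evidence on ground atoms with three distinct arguments. -/
def veryWideFactor (ar : Fin r → ℕ) (d : Data) : ℝ :=
  ∏ i ∈ Finset.range d.q, if IsVeryWide ar d i ∧ d.ev i ≠ 2 then 1 / 2 else 1

/-- The denominator is the same sum with the evidence erased. The power of two due to atoms with
three or more distinct arguments is omitted on both sides, since it cancels. -/
def liftedProb (b : ℕ) (F : Fin m → Formula ar) (d : Data) : ℝ :=
  liftedSum b F d * veryWideFactor ar d / liftedSum b F { d with ev := fun _ => 2 }

/-! ### Correctness of the lifted formula -/

section Encoded

variable {n q : ℕ} {d : Data} {w : Fin m → ℝ} {V : Fin q → GroundAtom ar n}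
  {e : Fin q → Option Bool}

theorem Encodes.forget (h : Encodes d w V e) :
    Encodes { d with ev := fun _ => 2 } w V (fun _ => none) :=
  ⟨h.n_eq, h.q_eq, h.W, h.pd, h.arg, fun _ => rfl⟩

-- Agreement with the evidence becomes a product over single ground atoms, the form that
-- `sum_worldWeight` accepts.
open Classical in
theorem sum_agrees (F : Fin m → Formula ar) (w : Fin m → ℝ) (V : Fin q → GroundAtom ar n)
    (e : Fin q → Option Bool) :
    (∑ ω : GroundAtom ar n → Bool with Agrees (fun i => ω (V i)) e, worldWeight F w ω) =
      ∑ ω : GroundAtom ar n → Bool, worldWeight F w ω *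
        ∏ a, if ∃ i, V i = a ∧ e i = some (!ω a) then (0 : ℝ) else 1 := by
  rw [Finset.sum_filter]
  refine Finset.sum_congr rfl fun ω _ => ?_
  split_ifs with h
  · rw [Finset.prod_eq_one fun a _ => if_neg ?_, mul_one]
    rintro ⟨i, rfl, hi⟩
    have := h i _ hi
    simp at this
  · simp only [Agrees, not_forall] at h
    obtain ⟨i, x, hx, hne⟩ := h
    symm
    refine mul_eq_zero_of_right _ (Finset.prod_eq_zero (Finset.mem_univ (V i)) (if_pos ?_))
    refine ⟨i, rfl, ?_⟩
    rw [Option.mem_def] at hx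
    rw [hx]
    cases x <;> simp_all

-- An observed atom contributes `1` and any other `2`. As `V` is injective, observed atoms may be
-- counted by their indices.
open Classical in
theorem Encodes.prod_veryWide (h : Encodes d w V e) (hV : Function.Injective V) :
    (∏ a : {a : GroundAtom ar n // 2 < a.width},
      ∑ x, if ∃ i, V i = a.1 ∧ e i = some (!x) then (0 : ℝ) else 1) =
      2 ^ Fintype.card {a : GroundAtom ar n // 2 < a.width} * veryWideFactor ar d := by
  have h1 : ∀ a : GroundAtom ar n, (∑ x, if ∃ i, V i = a ∧ e i = some (!x) then (0 : ℝ) else 1) =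
      2 * if ∃ i, V i = a ∧ e i ≠ none then 1 / 2 else 1 := by
    intro a
    rw [Fintype.sum_bool]
    by_cases hi : ∃ i, V i = a
    · obtain ⟨i, rfl⟩ := hi
      have hi : ∀ p : Fin q → Prop, (∃ k, V k = V i ∧ p k) ↔ p i := fun p =>
        ⟨fun ⟨k, hk, hp⟩ => hV hk ▸ hp, fun hp => ⟨i, rfl, hp⟩⟩
      simp only [hi]
      rcases e i with _ | _ | _
      · simp; norm_num
      · simp
      · simp
    · have hi' : ∀ p : Fin q → Prop, ¬ ∃ k, V k = a ∧ p k := fun p ⟨k, hk, _⟩ => hi ⟨k, hk⟩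
      simp only [hi', if_false]
      norm_num
  simp only [h1, Finset.prod_mul_distrib, Finset.prod_const, Finset.card_univ]
  congr 1
  rw [veryWideFactor, h.q_eq, Finset.prod_range]
  simp only [h.isVeryWide_iff, h.ev, ne_eq, encodeEvidence_eq_two]
  rw [← Finset.prod_filter, ← Finset.prod_filter, Finset.prod_const, Finset.prod_const]
  congr 1
  symm
  refine Finset.card_bij (fun i hi => ⟨V i, (Finset.mem_filter.1 hi).2.1⟩) ?_ ?_ ?_
  · intro i hi
    exact Finset.mem_filter.2 ⟨Finset.mem_univ _, i, rfl, (Finset.mem_filter.1 hi).2.2⟩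
  · intro i _ j _ hij
    exact hV (congrArg Subtype.val hij)
  · rintro ⟨a, ha⟩ hi
    obtain ⟨i, rfl, hei⟩ := (Finset.mem_filter.1 hi).2
    exact ⟨i, Finset.mem_filter.2 ⟨Finset.mem_univ _, ha, hei⟩, rfl⟩

-- A listed atom whose arguments are exactly `cd` would be wide, and both constants would have
-- slots. So every evidence factor of the pair is `1`.
open Classical in
theorem Encodes.pairWeight_eq_free (h : Encodes d w V e) {b : ℕ}
    (hb : (Finset.univ.filter fun i => 1 < (V i).width).card ≤ b) (F : Fin m → Formula ar)
    (ν : SAtom ar 0 → Bool) (cd : Pairs n) (u v : SAtom ar 1 → Bool)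
    (hs : slotOf ar b d cd.1.1 = none ∨ slotOf ar b d cd.1.2 = none) :
    pairWeight F d ν cd.1.1 cd.1.2 u v = freePairWeight F d ν u v := by
  refine Finset.sum_congr rfl fun t _ => ?_
  rw [Finset.prod_eq_one, mul_one]
  intro a _
  have hpl : (fun j => ![(cd.1.1 : ℕ), cd.1.2] (a.2.1 j)) =
      fun j => (((place (ar := ar) (.inr (.inr (cd, a)))).2 j : Fin n) : ℕ) := by
    funext j
    simp only [place, spread]
    generalize a.2.1 j = k
    fin_cases k <;> rfl
  have hev := h.evFactor_eq (place (.inr (.inr (cd, a)))) (t a)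
  rw [← hpl] at hev
  refine hev.trans (if_neg ?_)
  rintro ⟨i, hi, -⟩
  have harg : ∀ k : Fin 2, ∃ j, (V i).2 j = ![cd.1.1, cd.1.2] k := by
    intro k
    rw [hi]
    obtain ⟨j, hj⟩ := a.2.2 k
    exact ⟨j, by simp only [place, spread, hj]⟩
  obtain ⟨j, hj⟩ := harg 0
  obtain ⟨j', hj'⟩ := harg 1
  simp only [Matrix.cons_val_zero, Matrix.cons_val_one] at hj hj'
  have hw : 1 < (V i).width := by
    rw [Atom.width, Finset.one_lt_card]
    exact ⟨_, Finset.mem_image_of_mem _ (Finset.mem_univ j), _,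
      Finset.mem_image_of_mem _ (Finset.mem_univ j'), by rw [hj, hj']; exact cd.2.ne⟩
  rcases hs with hs | hs
  · exact h.slotOf_ne_none hb hw j (by rw [hj, hs])
  · exact h.slotOf_ne_none hb hw j' (by rw [hj', hs])

theorem Encodes.restWeight_eq (h : Encodes d w V e) {b : ℕ}
    (hb : (Finset.univ.filter fun i => 1 < (V i).width).card ≤ b) (F : Fin m → Formula ar)
    (ν : SAtom ar 0 → Bool) :
    restWeight n (typeWeight b F d ν) (typePairWeight b F d ν) n (fun _ => 0) =
      ∑ τ : Fin n → SAtom ar 1 → Bool, (∏ c : Fin n, unaryWeight F d ν c (τ c)) *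
        ∏ cd : Pairs n, pairWeight F d ν cd.1.1 cd.1.2 (τ cd.1.1) (τ cd.1.2) := by
  rw [← sum_seqWeight, ← sum_seqWeight_label (slotOf ar b d) (unaryWeight F d ν)
    (pairWeight F d ν) (typePairWeight b F d ν)]
  · rfl
  · intro c c' u v hlt hn
    unfold typePairWeight
    have hfree := h.pairWeight_eq_free hb F ν ⟨(⟨c, hlt.trans hn⟩, ⟨c', hn⟩), hlt⟩ u v
    simp only at hfree
    cases hc : slotOf ar b d c with
    | none => exact (hfree (.inl hc)).symm
    | some s =>
      cases hc' : slotOf ar b d c' with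
      | none => exact (hfree (.inr hc')).symm
      | some s' => simp only [slotElt_of_slotOf hc, slotElt_of_slotOf hc']

open Classical in
theorem Encodes.sum_agrees_eq (h : Encodes d w V e) (hV : Function.Injective V) {b : ℕ}
    (hb : (Finset.univ.filter fun i => 1 < (V i).width).card ≤ b) (F : Fin m → Formula ar)
    (hF : ∀ i, (F i).vars.card ≤ 2) :
    (∑ ω : GroundAtom ar n → Bool with Agrees (fun i => ω (V i)) e, worldWeight F w ω) =
      liftedSum b F d * (2 ^ Fintype.card {a : GroundAtom ar n // 2 < a.width} *
        veryWideFactor ar d) := by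
  rw [sum_agrees, sum_worldWeight F hF w
    (fun a x => if ∃ i, V i = a ∧ e i = some (!x) then (0 : ℝ) else 1), h.prod_veryWide hV,
    liftedSum]
  congr 1
  have hW : (fun i => Real.exp (w i)) = fun i : Fin m => d.W i := funext fun i => (h.W i).symm
  refine Finset.sum_congr rfl fun ν _ => ?_
  rw [hW]
  congr 2
  · refine Finset.prod_congr rfl fun a _ => ?_
    rw [← h.evFactor_eq]
    congr 1
    funext j
    exact (a.2.1 j).elim0
  · rw [h.n_eq, h.restWeight_eq hb]
    refine Finset.sum_congr rfl fun τ _ => ?_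
    congr 1
    · refine Finset.prod_congr rfl fun c _ => ?_
      rw [unaryWeight]
      congr 1
      refine Finset.prod_congr rfl fun a _ => ?_
      rw [← h.evFactor_eq]
      congr 1
      funext j
      simp [place, spread]
    · refine Finset.prod_congr rfl fun cd _ => ?_
      rw [pairWeight]
      refine Finset.sum_congr rfl fun t _ => ?_
      congr 1
      refine Finset.prod_congr rfl fun a _ => ?_
      rw [← h.evFactor_eq]
      congr 1
      funext j
      simp only [place, spread]
      generalize a.2.1 j = k
      fin_cases k <;> rfl

theorem Encodes.liftedProb_eq (h : Encodes d w V e) (hV : Function.Injective V) {b : ℕ}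
    (hb : (Finset.univ.filter fun i => 1 < (V i).width).card ≤ b) (F : Fin m → Formula ar)
    (hF : ∀ i, (F i).vars.card ≤ 2) : liftedProb b F d = prob F w V e := by
  classical
  have h1 := h.sum_agrees_eq hV hb F hF
  have h2 := h.forget.sum_agrees_eq hV hb F hF
  have h3 : veryWideFactor ar { d with ev := fun _ => 2 } = 1 :=
    Finset.prod_eq_one fun i _ => if_neg fun hi => hi.2 rfl
  have h4 : (∑ ω : GroundAtom ar n → Bool with Agrees (fun i => ω (V i)) (fun _ => none),
      worldWeight F w ω) = ∑ ω : GroundAtom ar n → Bool, worldWeight F w ω := by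
    congr 1
    exact Finset.filter_true_of_mem fun ω _ i v hv => by simp at hv
  rw [h4, h3, mul_one] at h2
  unfold prob liftedProb
  rw [h2]
  have h5 : (2 : ℝ) ^ Fintype.card {a : GroundAtom ar n // 2 < a.width} ≠ 0 := by positivity
  rw [← mul_div_mul_right _ _ h5, mul_right_comm, mul_assoc, ← h1]

end Encoded

end

end MarkovLogic

namespace MarkovLogic

noncomputable section

variable {r m : ℕ} {ar : Fin r → ℕ} {X Y : Type} {C : Ctx X}

/-! ### Computability of the lifted formula -/

theorem RComp.zero : RComp C (fun _ => 0) := by simpa using RComp.const (C := C) 0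

theorem RComp.one : RComp C (fun _ => 1) := by simpa using RComp.const (C := C) 1

/-- The numbers that describe an inference problem are computable. -/
structure DataComp (C : Ctx X) (m : ℕ) (d : X → Data) : Prop where
  n : NComp C (fun x => (d x).n)
  q : NComp C (fun x => (d x).q)
  W : ∀ i < m, RComp C (fun x => (d x).W i)
  pd : NFun C (fun x => (d x).pd)
  ev : NFun C (fun x => (d x).ev)
  arg : ∀ j, NFun C (fun x => (d x).arg j)

namespace DataComp

variable {d : X → Data}

theorem ext (hd : DataComp C m d) {E : Ctx Y} {π : Y → X} (h : Ext E C π) :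
    DataComp E m (fun y => d (π y)) :=
  ⟨hd.n.ext h, hd.q.ext h, fun i hi => (hd.W i hi).ext h, hd.pd.ext h, hd.ev.ext h,
    fun j => (hd.arg j).ext h⟩

theorem isAt (hd : DataComp C m d) {i : X → ℕ} (hi : NComp C i) (p : Fin r)
    {g : X → Fin (ar p) → ℕ} (hg : ∀ j, NComp C (fun x => g x j)) :
    TComp C (fun x => IsAt (d x) (i x) p (g x)) :=
  (TComp.eq (hd.pd.app hi) (.const p)).and (.forall fun j => TComp.eq ((hd.arg j).app hi) (hg j))

theorem isWide (hd : DataComp C m d) {i : X → ℕ} (hi : NComp C i) :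
    TComp C (fun x => IsWide ar (d x) (i x)) :=
  .exists fun p => (TComp.eq (hd.pd.app hi) (.const p)).and (.exists fun j => .exists fun j' =>
    (TComp.eq ((hd.arg j).app hi) ((hd.arg j').app hi)).not)

theorem isVeryWide (hd : DataComp C m d) {i : X → ℕ} (hi : NComp C i) :
    TComp C (fun x => IsVeryWide ar (d x) (i x)) :=
  .exists fun p => (TComp.eq (hd.pd.app hi) (.const p)).and (.exists fun j => .exists fun j' =>
    .exists fun j'' => (TComp.eq ((hd.arg j).app hi) ((hd.arg j').app hi)).not.and
      ((TComp.eq ((hd.arg j).app hi) ((hd.arg j'').app hi)).not.and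
        (TComp.eq ((hd.arg j').app hi) ((hd.arg j'').app hi)).not))

theorem evFactor (hd : DataComp C m d) (p : Fin r) {g : X → Fin (ar p) → ℕ}
    (hg : ∀ j, NComp C (fun x => g x j)) (a : Bool) :
    RComp C (fun x => evFactor (d x) p (g x) a) :=
  RComp.prod_range hd.q fun _ _ _ h _ hv => RComp.ite
    (((hd.ext h).isAt hv p fun j => (hg j).ext h).and (TComp.eq ((hd.ext h).ev.app hv) (.const _)))
    .zero .one

theorem wideRank (hd : DataComp C m d) {i : X → ℕ} (hi : NComp C i) :
    NComp C (fun x => wideRank ar (d x) (i x)) :=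
  NComp.card_filter hi fun _ _ _ h _ hv => (hd.ext h).isWide hv

theorem slotElt (hd : DataComp C m d) {b : ℕ} (s : Slot ar b) :
    NComp C (fun x => slotElt (d x) s) :=
  NComp.sum_range hd.q fun _ _ _ h _ hv => NComp.ite
    (((hd.ext h).isWide hv).and (TComp.eq ((hd.ext h).wideRank hv) (.const _)))
    (((hd.ext h).arg s.2).app hv) (.const 0)

theorem slotOf_eq (hd : DataComp C m d) {b : ℕ} {c : X → ℕ} (hc : NComp C c)
    (o : Option (Slot ar b)) : TComp C (fun x => slotOf ar b (d x) (c x) = o) := by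
  have heq : ∀ s : Slot ar b, TComp C (fun x => MarkovLogic.slotElt (d x) s = c x) :=
    fun s => TComp.eq (hd.slotElt s) hc
  cases o with
  | none =>
    exact (TComp.forall fun s => (heq s).not).congr fun x _ _ => findIndex_eq_none.symm
  | some s =>
    refine ((heq s).and (TComp.forall (p := fun s' x => Fintype.equivFin (Slot ar b) s' <
      Fintype.equivFin (Slot ar b) s → MarkovLogic.slotElt (d x) s' ≠ c x) fun s' => ?_)).congr
        fun x _ _ => findIndex_eq_some.symm
    by_cases hlt : Fintype.equivFin (Slot ar b) s' < Fintype.equivFin (Slot ar b) s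
    · simpa only [hlt, forall_const] using (heq s').not
    · simpa only [hlt, false_imp_iff] using TComp.const True

/-- The formulas and tables are fixed, so the truth of each grounding is known when the program is
written; only the weights are read. -/
theorem cellWeight (hd : DataComp C m d) (F : Fin m → Formula ar) (k : ℕ)
    (ν : SAtom ar 0 → Bool) (τ : Fin k → SAtom ar 1 → Bool) (t : SAtom ar 2 → Bool) :
    RComp C (fun x => cellWeight F (fun i => (d x).W i) k ν τ t) := by
  unfold MarkovLogic.cellWeight localWeight
  exact RComp.prod fun i => RComp.prod fun _ => RComp.ite (TComp.const _) (hd.W i i.2) .one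

theorem unaryWeight (hd : DataComp C m d) (F : Fin m → Formula ar) (ν : SAtom ar 0 → Bool)
    {c : X → ℕ} (hc : NComp C c) (u : SAtom ar 1 → Bool) :
    RComp C (fun x => unaryWeight F (d x) ν (c x) u) :=
  (hd.cellWeight F _ _ _ _).mul (.prod fun a => hd.evFactor a.1 (fun _ => hc) _)

theorem freePairWeight (hd : DataComp C m d) (F : Fin m → Formula ar) (ν : SAtom ar 0 → Bool)
    (u v : SAtom ar 1 → Bool) : RComp C (fun x => freePairWeight F (d x) ν u v) :=
  .sum fun _ => hd.cellWeight F _ _ _ _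

theorem pairWeight (hd : DataComp C m d) (F : Fin m → Formula ar) (ν : SAtom ar 0 → Bool)
    {c c' : X → ℕ} (hc : NComp C c) (hc' : NComp C c') (u v : SAtom ar 1 → Bool) :
    RComp C (fun x => pairWeight F (d x) ν (c x) (c' x) u v) :=
  .sum fun _ => (hd.cellWeight F _ _ _ _).mul (.prod fun a => hd.evFactor a.1 (fun j => by
    generalize a.2.1 j = k
    fin_cases k
    · exact hc
    · exact hc') _)

theorem liftedSum (hd : DataComp C m d) (b : ℕ) (F : Fin m → Formula ar) :
    RComp C (fun x => liftedSum b F (d x)) := by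
  unfold MarkovLogic.liftedSum
  refine RComp.sum fun ν => RComp.mul (RComp.mul (RComp.prod fun a => ?_)
    (hd.cellWeight F _ _ _ _)) (RComp.restWeight (α := fun x => typeWeight b F (d x) ν)
      (ρ := fun x => typePairWeight b F (d x) ν) hd.n ?_ ?_)
  · exact hd.evFactor a.1 (fun _ => .const 0) _
  · intro t Y E π h v hv
    exact RComp.ite ((hd.ext h).slotOf_eq hv t.2) ((hd.ext h).unaryWeight F ν hv t.1) .zero
  · rintro ⟨u, o⟩ ⟨v, o'⟩
    cases o with
    | none => exact hd.freePairWeight F ν u v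
    | some s =>
      cases o' with
      | none => exact hd.freePairWeight F ν u v
      | some s' => exact hd.pairWeight F ν (hd.slotElt s) (hd.slotElt s') u v

theorem veryWideFactor (hd : DataComp C m d) :
    RComp C (fun x => veryWideFactor ar (d x)) :=
  RComp.prod_range hd.q fun _ _ _ h _ hv => RComp.ite
    (((hd.ext h).isVeryWide hv).and (TComp.eq ((hd.ext h).ev.app hv) (.const 2)).not)
    (by simpa using RComp.const (1 / 2)) .one

theorem liftedProb (hd : DataComp C m d) (b : ℕ) (F : Fin m → Formula ar) :
    RComp C (fun x => liftedProb b F (d x)) := by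
  have hd' : DataComp C m (fun x => { d x with ev := fun _ => 2 }) :=
    ⟨hd.n, hd.q, hd.W, hd.pd, fun _ _ _ _ _ _ => .const 2, hd.arg⟩
  exact ((hd.liftedSum b F).mul hd.veryWideFactor).div (hd'.liftedSum b F)

end DataComp

end

end MarkovLogic

namespace MarkovLogic

noncomputable section

variable {r m : ℕ} {ar : Fin r → ℕ} {b : ℕ} {X : Type} {C : Ctx X}

/-! ### The input -/

theorem NFun.of_array {a : X → ℕ → ℕ} {k : ℕ}
    (hrep : ∀ x s, C.rep x s → s.nat k = a x)
    (hb : ∃ p : Polynomial ℕ, ∀ x i, a x i ≤ p.eval (C.size x)) : NFun C a := by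
  intro Y E π h v hv
  obtain ⟨p, hp⟩ := hb
  refine ⟨⟨p, fun y s _ => (hp _ _).trans_eq (by rw [h.size])⟩, fun L hL => ?_⟩
  refine (hv.run_self hL).seq (.setNat le_rfl (.const 0) (.get k (.get L (.const 0))) ?_)
  rintro y s ⟨h1, h2⟩
  simp [State.updNat_nat, NatExp.eval, h2, hrep _ s (h.rep y s h1)]

/-- The inputs of the algorithms. -/
structure Problem (m : ℕ) {r : ℕ} (ar : Fin r → ℕ) (b : ℕ) : Type where
  w : Fin m → ℝ
  n : ℕ
  q : ℕ
  V : Fin q → GroundAtom ar n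
  e : Fin q → Option Bool
  inj : Function.Injective V
  wide : (Finset.univ.filter fun i => 1 < (V i).width).card ≤ b

namespace Problem

def input (x : Problem m ar b) : State := inputState x.w x.V x.e

def data (x : Problem m ar b) : Data where
  n := x.n
  q := x.q
  W := x.input.real 0
  pd := x.input.nat 1
  ev := x.input.nat 2
  arg j := x.input.nat (j + 4)

theorem encodes (x : Problem m ar b) : Encodes x.data x.w x.V x.e where
  n_eq := rfl
  q_eq := rfl
  W i := by simp [data, input, inputState]
  pd i := by simp [data, input, inputState]
  arg i j := by simp [data, input, inputState]
  ev i := by simp [data, input, inputState]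

/-- The memory still contains the input; array `3` may have changed. -/
def ctx (m : ℕ) {r : ℕ} (ar : Fin r → ℕ) (b : ℕ) : Ctx (Problem m ar b) where
  rep x s := (∀ k < ∑ p, ar p + 4, k ≠ 3 → s.nat k = x.input.nat k) ∧ s.real 0 = x.input.real 0
  size x := x.n
  level := ∑ p, ar p + 4
  stable x s s' hs h := ⟨fun k hk h3 => (hs k hk).1.trans (h.1 k hk h3),
    (hs 0 (by omega)).2.trans h.2⟩

/-- Time is measured in the domain size, so the list must be short. An atom with at most one
distinct argument is determined by its predicate and its first argument, if any; at most `b` further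
atoms are listed. -/
theorem q_le (x : Problem m ar b) : x.q ≤ r * (x.n + 1) + b := by
  classical
  have h1 := Finset.card_filter_add_card_filter_not (s := (Finset.univ : Finset (Fin x.q)))
    (fun i => 1 < (x.V i).width)
  have h2 : (Finset.univ.filter fun i => ¬ 1 < (x.V i).width).card ≤ r * (x.n + 1) := by
    have hcard : Fintype.card (Fin r × Option (Fin x.n)) = r * (x.n + 1) := by simp
    rw [← hcard, ← Finset.card_univ]
    refine Finset.card_le_card_of_injOn
      (fun i => ((x.V i).1, if h : 0 < ar (x.V i).1 then some ((x.V i).2 ⟨0, h⟩) else none))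
      (fun _ _ => Finset.mem_univ _) ?_
    intro i hi i' hi' he
    have hw : (x.V i).width ≤ 1 := by simpa using hi
    have hw' : (x.V i').width ≤ 1 := by simpa using hi'
    apply x.inj
    simp only [Prod.mk.injEq] at he
    revert hw hw' he
    generalize x.V i = a
    generalize x.V i' = a'
    obtain ⟨p, g⟩ := a
    obtain ⟨p', g'⟩ := a'
    rintro hw hw' ⟨he0, he⟩
    simp only at he0 he
    subst he0
    congr 1
    funext j
    have hp : 0 < ar p := j.pos
    rw [dif_pos hp, dif_pos hp, Option.some_inj] at he
    have e1 := Finset.card_le_one.1 hw (g j) (Finset.mem_image_of_mem _ (Finset.mem_univ _))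
      (g ⟨0, hp⟩) (Finset.mem_image_of_mem _ (Finset.mem_univ _))
    have e2 := Finset.card_le_one.1 hw' (g' j) (Finset.mem_image_of_mem _ (Finset.mem_univ _))
      (g' ⟨0, hp⟩) (Finset.mem_image_of_mem _ (Finset.mem_univ _))
    rw [e1, e2, he]
  have h3 := x.wide
  simp only [Finset.card_univ, Fintype.card_fin] at h1
  omega

theorem dataComp : DataComp (ctx m ar b) m (fun x => x.data) where
  n := by
    refine ⟨⟨Polynomial.X, fun x s _ => by simp [ctx, data]⟩, fun L hL => ?_⟩
    refine .setNat le_rfl (.const 0) (.get 0 (.const 0)) fun x s hs => ?_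
    simp [State.updNat_nat, NatExp.eval, hs.1 0 (by omega) (by omega), input, inputState, data]
  q := by
    refine ⟨⟨Polynomial.C r * (Polynomial.X + Polynomial.C 1) + Polynomial.C b,
      fun x s _ => by simpa [ctx, data] using x.q_le⟩, fun L hL => ?_⟩
    refine .setNat le_rfl (.const 0) (.get 0 (.const 1)) fun x s hs => ?_
    simp [State.updNat_nat, NatExp.eval, hs.1 0 (by omega) (by omega), input, inputState, data]
  W i hi L hL := by
    refine .setReal le_rfl (.const 0) (.get 0 (.const i)) fun x s hs => ?_
    simp [State.updReal_real, NatExp.eval, RealExp.eval, hs.2, data]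
  pd := by
    refine NFun.of_array (k := 1)
      (fun x s hs => hs.1 1 (by omega) (by omega)) ⟨Polynomial.C r, fun x i => ?_⟩
    simp only [data, input, inputState, Polynomial.eval_C]
    split_ifs
    · exact (Fin.is_lt _).le
    · exact Nat.zero_le _
  ev := by
    refine NFun.of_array (k := 2)
      (fun x s hs => hs.1 2 (by omega) (by omega)) ⟨Polynomial.C 2, fun x i => ?_⟩
    simp only [data, input, inputState, Polynomial.eval_C]
    split_ifs with h
    · rcases x.e ⟨i, h⟩ with _ | _ | _ <;> simp [encodeEvidence]
    · exact Nat.zero_le _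
  arg j := by
    by_cases hj : j < ∑ p, ar p
    · refine NFun.of_array (k := j + 4)
        (fun x s hs => hs.1 (j + 4) (by omega) (by omega)) ⟨Polynomial.X, fun x i => ?_⟩
      simp only [data, input, inputState, Polynomial.eval_X]
      split_ifs
      · exact (Fin.is_lt _).le
      · exact Nat.zero_le _
      · exact Nat.zero_le _
    -- The context covers only finitely many argument arrays. No predicate has an argument with such
    -- a large index `j`, so the value is `0`.
    · intro Y E π _ v _
      refine (NComp.const 0).congr fun y s _ => ?_
      simp only [data, input, inputState]
      split_ifs with h1 h2
      · exact absurd (h2.trans_le (Finset.single_le_sum (f := ar) (fun _ _ => Nat.zero_le _)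
          (Finset.mem_univ _))) hj
      · rfl
      · rfl

theorem ctx_rep_input (x : Problem m ar b) : (ctx m ar b).rep x x.input :=
  ⟨fun _ _ _ => rfl, rfl⟩

end Problem

/-- Marginal inference is domain-lifted. -/
theorem exists_marginal_program (F : Fin m → Formula ar) (hF : ∀ i, (F i).vars.card ≤ 2) (b : ℕ) :
    ∃ (P : Program) (p : Polynomial ℕ), ∀ x : Problem m ar b,
      ∃ (N : ℕ) (s : State), Runs P (inputState x.w x.V x.e) N s ∧ N ≤ p.eval x.n ∧
        s.real 1 0 = prob F x.w x.V x.e := by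
  have h : Does (Problem.ctx m ar b).rep (Problem.ctx m ar b).size 0
      (fun x s => s.real 1 0 = prob F x.w x.V x.e) := by
    refine (((Problem.dataComp.liftedProb b F) _ le_rfl).conseq (Nat.zero_le _) (fun _ _ h => h)
      (fun _ _ _ _ _ h => h)).seq
        (.setReal (Nat.zero_le 1) (.const 0) (.get (Problem.ctx m ar b).level (.const 0)) ?_)
    intro x s hx
    simp [State.updReal_real, NatExp.eval, RealExp.eval, hx,
      x.encodes.liftedProb_eq x.inj x.wide F hF]
  obtain ⟨P, p, hP⟩ := h
  refine ⟨P, p, fun x => ?_⟩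
  obtain ⟨N, s, h1, h2, -, h3⟩ := hP x x.input x.ctx_rep_input
  exact ⟨N, s, h1, h2, h3⟩

end

end MarkovLogic

namespace MarkovLogic

noncomputable section

variable {r m : ℕ} {ar : Fin r → ℕ}

/-! ### Symmetry -/

/-- Formulas contain no constants, so composition with `π` merely permutes the groundings of each.
-/
theorem worldWeight_pull (F : Fin m → Formula ar) (w : Fin m → ℝ) {n : ℕ} (π : Equiv.Perm (Fin n))
    (ω : GroundAtom ar n → Bool) : worldWeight F w (pull π ω) = worldWeight F w ω := by
  unfold worldWeight
  refine Finset.prod_congr rfl fun i _ => ?_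
  simp only [← Formula.eval_pull]
  exact (Equiv.arrowCongr (Equiv.refl (F i).vars) π).prod_comp
    fun σ => if (F i).eval ω σ = true then Real.exp (w i) else 1

theorem worldWeight_pos (F : Fin m → Formula ar) (w : Fin m → ℝ) {n : ℕ}
    (ω : GroundAtom ar n → Bool) : 0 < worldWeight F w ω :=
  Finset.prod_pos fun i _ => Finset.prod_pos fun σ _ => by
    split_ifs
    · exact Real.exp_pos _
    · exact one_pos

/-- An assignment is at most as probable as one that a permutation of the domain transforms it
into. -/
theorem prob_le_of_perm (F : Fin m → Formula ar) (w : Fin m → ℝ) {n q : ℕ}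
    (V : Fin q → GroundAtom ar n) (y y' : Fin q → Bool) (π : Equiv.Perm (Fin n))
    (h : ∀ i, ∃ i', V i' = ⟨(V i).1, fun j => π ((V i).2 j)⟩ ∧ y' i' = y i) :
    prob F w V (fun i => some (y' i)) ≤ prob F w V (fun i => some (y i)) := by
  classical
  unfold prob
  refine div_le_div_of_nonneg_right ?_ (Finset.sum_nonneg fun ω _ => (worldWeight_pos F w ω).le)
  calc (∑ ω : GroundAtom ar n → Bool with Agrees (fun i => ω (V i)) (fun i => some (y' i)),
        worldWeight F w ω)
      = ∑ ω : GroundAtom ar n → Bool with Agrees (fun i => ω (V i)) (fun i => some (y' i)),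
        worldWeight F w (pull π ω) :=
        Finset.sum_congr rfl fun ω _ => (worldWeight_pull F w π ω).symm
    _ = ∑ ω ∈ (Finset.univ.filter fun ω : GroundAtom ar n → Bool =>
          Agrees (fun i => ω (V i)) (fun i => some (y' i))).image (pull π), worldWeight F w ω := by
        refine (Finset.sum_image fun ω _ ω' _ he => ?_).symm
        funext a
        have := congrFun he ⟨a.1, fun j => π.symm (a.2 j)⟩
        simpa [pull] using this
    -- The renamed worlds are among those that agree with `y`; this inclusion suffices for the
    -- inequality.
    _ ≤ _ := by
        refine Finset.sum_le_sum_of_subset_of_nonneg ?_ fun ω _ _ => (worldWeight_pos F w ω).le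
        intro ω hω
        obtain ⟨ω', hω', rfl⟩ := Finset.mem_image.1 hω
        refine Finset.mem_filter.2 ⟨Finset.mem_univ _, fun i v hv => ?_⟩
        obtain ⟨i', hi', hy⟩ := h i
        have := (Finset.mem_filter.1 hω').2 i' _ rfl
        simp only [Option.mem_def, Option.some_inj] at hv
        simp only [pull, ← hi']
        exact this.trans (hy.trans hv)

/-! ### Sorting -/

/-- After a permutation that preserves the values of `f`, each pair of values of `f` and `g` is
taken in an interval, within the positions with the same value of `f`. -/
theorem exists_perm_intervals {n : ℕ} {A B : Type} [Finite A] [Finite B] (f : Fin n → A)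
    (g : Fin n → B) : ∃ π : Equiv.Perm (Fin n), (∀ c, f (π c) = f c) ∧
      ∃ lo hi : A → B → ℕ, (∀ a u, lo a u < n + 2 ∧ hi a u < n + 2) ∧
        ∀ c u, (lo (f c) u ≤ (c : ℕ) ∧ (c : ℕ) < hi (f c) u) ↔ g (π c) = u := by
  classical
  have := Fintype.ofFinite A
  have := Fintype.ofFinite B
  set f' : Fin n → Fin (Fintype.card A) := fun c => Fintype.equivFin A (f c) with hf'
  set g' : Fin n → Fin (Fintype.card B) := fun c => Fintype.equivFin B (g c) with hg'
  -- `σ` sorts by `f` and then `g`, `σ'` by `f` and then position. Both list the classes of `f` in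
  -- the same order, so `σ'.symm` followed by `σ` preserves `f` and makes `g` monotone within each
  -- class.
  set σ := Tuple.sort (fun c => toLex (f' c, g' c)) with hσ
  set σ' := Tuple.sort (fun c => toLex (f' c, c)) with hσ'
  have hm : Monotone fun c => toLex (f' (σ c), g' (σ c)) :=
    Tuple.monotone_sort fun c => toLex (f' c, g' c)
  have hm' : Monotone fun c => toLex (f' (σ' c), σ' c) :=
    Tuple.monotone_sort fun c => toLex (f' c, c)
  have hfm : f' ∘ σ = f' ∘ σ' := by
    rw [Tuple.comp_sort_eq_comp_iff_monotone.2, ← Tuple.comp_sort_eq_comp_iff_monotone.2]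
    · intro a c h
      exact Prod.Lex.monotone_fst _ _ (hm' h)
    · intro a c h
      exact Prod.Lex.monotone_fst _ _ (hm h)
  set π : Equiv.Perm (Fin n) := σ'.symm.trans σ with hπ
  have hπf : ∀ c, f (π c) = f c := by
    intro c
    have := congrFun hfm (σ'.symm c)
    simp only [Function.comp_apply, Equiv.apply_symm_apply, hf'] at this
    exact (Fintype.equivFin A).injective this
  have hmono : ∀ c c', f c = f c' → c ≤ c' → g' (π c) ≤ g' (π c') := by
    intro c c' hcc h
    have h1 : σ'.symm c ≤ σ'.symm c' := by
      by_contra hlt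
      have := hm' (le_of_not_ge hlt)
      simp only [Equiv.apply_symm_apply, Prod.Lex.toLex_le_toLex, hf', hcc, lt_irrefl, false_or,
        true_and] at this
      have hcc' : c = c' := le_antisymm h this
      exact hlt (by rw [hcc'])
    have h2 := hm h1
    have h3 : f' (σ (σ'.symm c)) = f' (σ (σ'.symm c')) := by
      have : f (π c) = f (π c') := by rw [hπf, hπf, hcc]
      exact congrArg (Fintype.equivFin A) this
    simp only [Prod.Lex.toLex_le_toLex, h3, lt_irrefl, false_or, true_and] at h2
    exact h2
  refine ⟨π, hπf, ?_⟩
  have key : ∀ a u, ∃ lo hi : ℕ, (lo < n + 2 ∧ hi < n + 2) ∧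
      ∀ c : Fin n, f c = a → ((lo ≤ (c : ℕ) ∧ (c : ℕ) < hi) ↔ g (π c) = u) := by
    intro a u
    set S := Finset.univ.filter fun c => f c = a ∧ g (π c) = u with hS
    rcases S.eq_empty_or_nonempty with hE | hE
    · refine ⟨0, 0, by omega, fun c hc => ⟨fun h => by omega, fun h => ?_⟩⟩
      have : c ∈ S := by simp [hS, hc, h]
      rw [hE] at this
      simp at this
    · have hmin := Finset.mem_filter.1 (S.min'_mem hE)
      have hmax := Finset.mem_filter.1 (S.max'_mem hE)
      refine ⟨S.min' hE, (S.max' hE : ℕ) + 1, by omega, fun c hc => ⟨fun h => ?_, fun h => ?_⟩⟩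
      · have h1 := hmono (S.min' hE) c (by rw [hmin.2.1, hc]) h.1
        have h2 := hmono c (S.max' hE) (by rw [hmax.2.1, hc]) (Nat.le_of_lt_succ h.2)
        simp only [hg', hmin.2.2, hmax.2.2] at h1 h2
        exact (Fintype.equivFin B).injective (le_antisymm h2 h1)
      · have hcS : c ∈ S := by simp [hS, hc, h]
        exact ⟨S.min'_le c hcS, Nat.lt_succ_of_le (S.le_max' c hcS)⟩
  choose lo hi h1 h2 using key
  exact ⟨lo, hi, h1, fun c u => h2 _ u c rfl⟩

/-! ### Candidates for the most probable assignment -/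

/-- The slot of a constant, and for each of its unary atoms the evidence, if the atom is listed. -/
abbrev Key (ar : Fin r → ℕ) (b : ℕ) : Type := Option (Slot ar b) × (SAtom ar 1 → Fin 3 → Bool)

-- Constants with equal keys can be exchanged without disturbing the evidence or the set of listed
-- unary atoms; a constant with a slot shares its key with no other.
open Classical in
def keyOf (b : ℕ) (d : Data) (c : ℕ) : Key ar b :=
  (slotOf ar b d c,
    fun a s => decide (∃ i < d.q, IsAt (ar := ar) d i a.1 (fun _ => c) ∧ d.ev i = (s : ℕ)))

/-- The parameters of a candidate. -/
abbrev Param (ar : Fin r → ℕ) (b : ℕ) : Type :=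
  SAtom ar 0 ⊕ (Key ar b × (SAtom ar 1 → Bool) × Bool) ⊕ Fin b

/-- The value of a parameter in the candidate with number `θ`. -/
def digit {b : ℕ} (d : Data) (θ : ℕ) (x : Param ar b) : ℕ :=
  θ / (d.n + 2) ^ (Fintype.equivFin (Param ar b) x : ℕ) % (d.n + 2)

/-- The number of candidates. -/
def candCount (ar : Fin r → ℕ) (b : ℕ) (d : Data) : ℕ := (d.n + 2) ^ Fintype.card (Param ar b)

/-- In base `n + 2` there is room for interval ends, which need only reach `n`, and for the truth
values `0` and `1` even when the domain is empty. -/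
theorem exists_digit {b : ℕ} (d : Data) (g : Param ar b → ℕ) (hg : ∀ x, g x < d.n + 2) :
    ∃ θ < candCount ar b d, ∀ x, digit d θ x = g x := by
  set θ := finFunctionFinEquiv (fun i => (⟨g ((Fintype.equivFin (Param ar b)).symm i), hg _⟩ :
    Fin (d.n + 2))) with hθ
  refine ⟨θ, θ.2, fun x => ?_⟩
  have h : finFunctionFinEquiv.symm θ (Fintype.equivFin (Param ar b) x) = ⟨g x, hg x⟩ := by
    rw [hθ, Equiv.symm_apply_apply]
    simp
  exact congrArg Fin.val h

/-- The value of the `i`-th atom, if it is not in the evidence. -/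
def CandTrue (ar : Fin r → ℕ) (b : ℕ) (d : Data) (θ i : ℕ) : Prop :=
  (∃ a : SAtom ar 0, d.pd i = a.1 ∧ digit (b := b) d θ (.inl a) = 1) ∨
  (∃ (a : SAtom ar 1) (κ : Key ar b) (u : SAtom ar 1 → Bool), u a = true ∧
    IsAt (ar := ar) d i a.1 (fun _ => d.arg 0 i) ∧ keyOf b d (d.arg 0 i) = κ ∧
    digit (b := b) d θ (.inr (.inl (κ, u, false))) ≤ d.arg 0 i ∧
    d.arg 0 i < digit (b := b) d θ (.inr (.inl (κ, u, true)))) ∨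
  ∃ k : Fin b, IsWide ar d i ∧ wideRank ar d i = k ∧
    digit (ar := ar) (b := b) d θ (.inr (.inr k)) = 1

open Classical in
def cand (ar : Fin r → ℕ) (b : ℕ) (d : Data) (θ i : ℕ) : ℕ :=
  if d.ev i = 2 then if CandTrue ar b d θ i then 1 else 0 else d.ev i

def candData (ar : Fin r → ℕ) (b : ℕ) (d : Data) (θ : ℕ) : Data :=
  { d with ev := cand ar b d θ }

/-- The number of a most probable candidate. -/
def bestCand (b : ℕ) (F : Fin m → Formula ar) (d : Data) : ℕ :=
  firstBelow (candCount ar b d) fun θ => ∀ θ' < candCount ar b d,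
    liftedProb b F (candData ar b d θ') ≤ liftedProb b F (candData ar b d θ)

theorem bestCand_spec (b : ℕ) (F : Fin m → Formula ar) (d : Data) :
    ∀ θ < candCount ar b d, liftedProb b F (candData ar b d θ) ≤
      liftedProb b F (candData ar b d (bestCand b F d)) := by
  refine (firstBelow_spec (p := fun θ => ∀ θ' < candCount ar b d,
    liftedProb b F (candData ar b d θ') ≤ liftedProb b F (candData ar b d θ)) ?_).2
  obtain ⟨θ, h1, h2⟩ := Finset.exists_max_image (Finset.range (candCount ar b d))
    (fun θ => liftedProb b F (candData ar b d θ))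
    ⟨0, Finset.mem_range.2 (pow_pos (Nat.succ_pos _) _)⟩
  exact ⟨θ, Finset.mem_range.1 h1, fun θ' h => h2 θ' (Finset.mem_range.2 h)⟩

/-! ### Computability of the candidates -/

section Comp

variable {X : Type} {C : Ctx X} {d : X → Data} {b : ℕ}

namespace DataComp

theorem keyOf_eq (hd : DataComp C m d) {c : X → ℕ} (hc : NComp C c) (κ : Key ar b) :
    TComp C (fun x => keyOf b (d x) (c x) = κ) := by
  refine ((hd.slotOf_eq hc κ.1).and (TComp.forall fun a => TComp.forall fun s : Fin 3 =>
    TComp.iff_const (p := fun x => ∃ i < (d x).q,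
      IsAt (ar := ar) (d x) i a.1 (fun _ => c x) ∧ (d x).ev i = (s : ℕ))
    (TComp.exists_lt hd.q ?_) (κ.2 a s = true))).congr fun x _ _ => ?_
  · exact fun Y E π h v hv => ((hd.ext h).isAt hv a.1 fun _ => hc.ext h).and
      (TComp.eq ((hd.ext h).ev.app hv) (.const _))
  · classical
    rw [Prod.ext_iff, funext_iff]
    refine and_congr_right fun _ => forall_congr' fun a => ?_
    rw [funext_iff]
    refine forall_congr' fun s => ?_
    have h : (keyOf b (d x) (c x)).2 a s = true ↔
        ∃ i < (d x).q, IsAt (ar := ar) (d x) i a.1 (fun _ => c x) ∧ (d x).ev i = (s : ℕ) :=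
      decide_eq_true_iff
    rw [← h]
    exact Bool.eq_iff_iff.symm

theorem digit (hd : DataComp C m d) {θ : X → ℕ} (hθ : NComp C θ) (g : Param ar b) :
    NComp C (fun x => digit (d x) (θ x) g) :=
  (hθ.div ((hd.n.add (.const 2)).pow_const _)).mod (hd.n.add (.const 2))

theorem candTrue (hd : DataComp C m d) {θ i : X → ℕ} (hθ : NComp C θ) (hi : NComp C i) :
    TComp C (fun x => CandTrue ar b (d x) (θ x) (i x)) := by
  have h0 := (hd.arg 0).app hi
  refine TComp.or (.exists fun a => (TComp.eq (hd.pd.app hi) (.const _)).and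
    (TComp.eq (hd.digit hθ _) (.const 1))) (TComp.or (.exists fun a => .exists fun κ =>
      .exists fun u => (TComp.const _).and ((hd.isAt hi _ fun _ => h0).and
        ((hd.keyOf_eq h0 κ).and ((TComp.le (hd.digit hθ _) h0).and
          (TComp.lt h0 (hd.digit hθ _)))))) ?_)
  exact .exists fun k => (hd.isWide hi).and ((TComp.eq (hd.wideRank hi) (.const _)).and
    (TComp.eq (hd.digit hθ _) (.const 1)))

theorem cand (hd : DataComp C m d) {θ i : X → ℕ} (hθ : NComp C θ) (hi : NComp C i) :
    NComp C (fun x => cand ar b (d x) (θ x) (i x)) :=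
  .ite (TComp.eq (hd.ev.app hi) (.const 2)) (.ite (hd.candTrue hθ hi) (.const 1) (.const 0))
    (hd.ev.app hi)

theorem candData (hd : DataComp C m d) {θ : X → ℕ} (hθ : NComp C θ) :
    DataComp C m (fun x => candData ar b (d x) (θ x)) :=
  ⟨hd.n, hd.q, hd.W, hd.pd, fun _ _ _ h _ hv => (hd.ext h).cand (hθ.ext h) hv, hd.arg⟩

/-- The number of parameters depends only on the signature and `b`, so there are polynomially many
candidates and all pairs of them can be compared. -/
theorem bestCand (hd : DataComp C m d) (F : Fin m → Formula ar) :
    NComp C (fun x => bestCand b F (d x)) := by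
  have hcount : NComp C (fun x => candCount ar b (d x)) := (hd.n.add (.const 2)).pow_const _
  refine NComp.firstBelow hcount fun Y E π h v hv => ?_
  refine TComp.forall_lt (hcount.ext h) fun Z E' π' h' v' hv' => ?_
  exact TComp.real_le (((hd.ext (h'.trans h)).candData hv').liftedProb b F)
    (((hd.ext (h'.trans h)).candData (hv.ext h')).liftedProb b F)

end DataComp

end Comp

end

end MarkovLogic

namespace MarkovLogic

noncomputable section

variable {r m : ℕ} {ar : Fin r → ℕ} {b n q : ℕ} {d : Data} {w : Fin m → ℝ}
  {V : Fin q → GroundAtom ar n} {e : Fin q → Option Bool}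

/-! ### Correctness of the candidates -/

theorem SAtom.ext_one {a a' : SAtom ar 1} (h : a.1 = a'.1) : a = a' := by
  obtain ⟨p, σ⟩ := a
  obtain ⟨p', σ'⟩ := a'
  obtain rfl : p = p' := h
  rw [Subsingleton.elim σ σ']

theorem SAtom.arity_zero (a : SAtom ar 0) : ar a.1 = 0 := by
  by_contra h
  exact (a.2.1 ⟨0, Nat.pos_of_ne_zero h⟩).elim0

theorem SAtom.arity_pos (a : SAtom ar 1) : 0 < ar a.1 := by
  obtain ⟨j, -⟩ := a.2.2 0
  exact j.pos

theorem one_lt_width_place (cd : Pairs n) (a : SAtom ar 2) :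
    1 < (place (.inr (.inr (cd, a))) : GroundAtom ar n).width := by
  obtain ⟨j, hj⟩ := a.2.2 0
  obtain ⟨j', hj'⟩ := a.2.2 1
  rw [Atom.width, Finset.one_lt_card]
  refine ⟨_, Finset.mem_image_of_mem _ (Finset.mem_univ j), _,
    Finset.mem_image_of_mem _ (Finset.mem_univ j'), ?_⟩
  simpa [place, spread, hj, hj'] using cd.2.ne

theorem Encodes.isAt_unary_iff (h : Encodes d w V e) (i : Fin q) (c : Fin n) (a : SAtom ar 1) :
    IsAt (ar := ar) d i a.1 (fun _ => (c : ℕ)) ↔ V i = place (.inr (.inl (c, a))) := by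
  rw [← h.isAt_iff]
  simp [place, spread]

theorem Encodes.cand_eq (h : Encodes d w V e) (θ : ℕ) (i : Fin q) :
    cand ar b d θ i = encodeEvidence (some (decide (cand ar b d θ i = 1))) := by
  have hev := h.ev i
  cases hei : e i with
  | none =>
    rw [hei] at hev
    by_cases hc : CandTrue ar b d θ i <;> simp [cand, hev, encodeEvidence, hc]
  | some x =>
    rw [hei] at hev
    cases x <;> simp [cand, hev, encodeEvidence]

theorem Encodes.candData (h : Encodes d w V e) (θ : ℕ) :
    Encodes (candData ar b d θ) w V (fun i => some (decide (cand ar b d θ i = 1))) :=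
  ⟨h.n_eq, h.q_eq, h.W, h.pd, h.arg, h.cand_eq θ⟩

theorem Encodes.cand_of_some (h : Encodes d w V e) (θ : ℕ) {i : Fin q} {x : Bool}
    (hx : e i = some x) : decide (cand ar b d θ i = 1) = x := by
  have hev := h.ev i
  rw [hx] at hev
  cases x <;> simp [cand, hev, encodeEvidence]

theorem Encodes.cand_of_none (h : Encodes d w V e) (θ : ℕ) {i : Fin q}
    (hx : e i = none) : decide (cand ar b d θ i = 1) = true ↔ CandTrue ar b d θ i := by
  have hev := h.ev i
  rw [hx] at hev
  by_cases hc : CandTrue ar b d θ i <;> simp [cand, hev, encodeEvidence, hc]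

/-- A key records which unary atoms are listed and with which evidence code, including `2` for
unassigned ones. -/
theorem Encodes.exists_of_keyOf_eq (h : Encodes d w V e) {i : Fin q}
    {c c' : Fin n} {a : SAtom ar 1} (hi : V i = place (.inr (.inl (c, a))))
    (hc : keyOf (ar := ar) b d c' = keyOf b d c) :
    ∃ i', V i' = place (.inr (.inl (c', a))) ∧ e i' = e i := by
  classical
  have hlt : encodeEvidence (e i) < 3 := by
    rcases e i with _ | _ | _ <;> simp [encodeEvidence]
  have h1 := congrFun (congrFun (congrArg Prod.snd hc) a) ⟨_, hlt⟩
  have h2 : (keyOf (ar := ar) b d c).2 a ⟨_, hlt⟩ = true :=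
    decide_eq_true ⟨i, h.q_eq ▸ i.2, (h.isAt_unary_iff i c a).2 hi, h.ev i⟩
  rw [h2] at h1
  obtain ⟨i', hlt', h3, h4⟩ := of_decide_eq_true h1
  rw [h.q_eq] at hlt'
  refine ⟨⟨i', hlt'⟩, (h.isAt_unary_iff ⟨i', hlt'⟩ c' a).1 h3, ?_⟩
  have h5 := (h.ev ⟨i', hlt'⟩).symm.trans h4
  simp only at h5
  revert h5
  generalize e ⟨i', hlt'⟩ = o
  generalize e i = o'
  rcases o with _ | _ | _ <;> rcases o' with _ | _ | _ <;> simp [encodeEvidence]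

/-- Every assignment is at most as probable as one of the candidates. -/
theorem Encodes.exists_cand (h : Encodes d w V e) (hV : Function.Injective V)
    (hb : (Finset.univ.filter fun i => 1 < (V i).width).card ≤ b) (F : Fin m → Formula ar)
    {y' : Fin q → Bool} (hy' : Agrees y' e) : ∃ θ < candCount ar b d,
      prob F w V (fun i => some (y' i)) ≤
        prob F w V (fun i => some (decide (cand ar b d θ i = 1))) := by
  classical
  -- The table that `y'` prescribes over `c`, with `false` for unlisted atoms.
  set g : Fin n → SAtom ar 1 → Bool := fun c a =>
    decide (∃ i, V i = place (.inr (.inl (c, a))) ∧ y' i = true) with hg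
  obtain ⟨π, hπ, lo, hi, hlohi, hint⟩ :=
    exists_perm_intervals (fun c : Fin n => keyOf (ar := ar) b d c) g
  set G : Param ar b → ℕ := fun x => match x with
    | .inl a => if ∃ i, V i = place (.inl a) ∧ y' i = true then 1 else 0
    | .inr (.inl (κ, u, false)) => lo κ u
    | .inr (.inl (κ, u, true)) => hi κ u
    | .inr (.inr k) =>
      if ∃ i : Fin q, IsWide ar d i ∧ wideRank ar d i = k ∧ y' i = true then 1 else 0 with hG
  obtain ⟨θ, hθ, hdig⟩ := exists_digit d G (by
    rw [h.n_eq]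
    rintro (a | ⟨κ, u, _ | _⟩ | k) <;> simp only [hG]
    · split_ifs <;> omega
    · exact (hlohi κ u).1
    · exact (hlohi κ u).2
    · split_ifs <;> omega)
  refine ⟨θ, hθ, prob_le_of_perm F w V _ _ π fun i => ?_⟩
  by_cases hw : 1 < (V i).width
  · refine ⟨i, ?_, ?_⟩
    -- `π` preserves keys, hence slots, and a slot determines its constant; so `π` fixes all
    -- arguments of wide atoms.
    · have hfix : ∀ j, π ((V i).2 j) = (V i).2 j := by
        intro j
        have h1 := congrArg Prod.fst (hπ ((V i).2 j))
        simp only [keyOf] at h1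
        obtain ⟨s, hs⟩ := Option.ne_none_iff_exists'.1 (h.slotOf_ne_none hb hw j)
        rw [hs] at h1
        exact Fin.ext ((slotElt_of_slotOf h1).symm.trans (slotElt_of_slotOf hs))
      simp only [hfix]
    · cases hei : e i with
      | some x => rw [h.cand_of_some θ hei, hy' i x hei]
      | none =>
        rw [Bool.eq_iff_iff, h.cand_of_none θ hei]
        have hwi := (h.isWide_iff i).2 hw
        constructor
        · intro hy
          refine .inr (.inr ⟨⟨_, h.wideRank_lt hb hw⟩, hwi, rfl, ?_⟩)
          rw [hdig]
          exact if_pos ⟨i, hwi, rfl, hy⟩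
        · rintro (⟨a, ha, -⟩ | ⟨a, κ, u, -, ha, -⟩ | ⟨k, -, hk, hd⟩)
          · obtain ⟨p, hp, j, -⟩ := hwi
            obtain rfl : a.1 = p := Fin.ext (ha.symm.trans hp)
            exact absurd j.pos (by rw [a.arity_zero]; omega)
          · obtain ⟨p, hp, j, j', hj⟩ := hwi
            obtain rfl : a.1 = p := Fin.ext (ha.1.symm.trans hp)
            exact absurd ((ha.2 j).trans (ha.2 j').symm) hj
          · rw [hdig] at hd
            simp only [hG] at hd
            split_ifs at hd with hex
            obtain ⟨i', hw', hr, hy⟩ := hex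
            have : i' = i := by
              by_contra hne
              rcases lt_or_gt_of_ne (fun he => hne (Fin.ext he) : (i' : ℕ) ≠ i) with hlt | hlt
              · exact (wideRank_lt_of_lt hw' hlt).ne (hr.trans hk.symm)
              · exact (wideRank_lt_of_lt hwi hlt).ne (hk.trans hr.symm)
            rwa [this] at hy
  · obtain ⟨x, hx⟩ : V i ∈ Set.range place := mem_range_place.2 (by omega)
    have hnw : ¬ IsWide ar d i := fun hh => hw ((h.isWide_iff i).1 hh)
    rcases x with a | ⟨c, a⟩ | ⟨cd, a⟩
    · refine ⟨i, ?_, ?_⟩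
      · rw [← hx]
        simp only [place]
        congr 1
        funext j
        exact (a.2.1 j).elim0
      · cases hei : e i with
        | some x => rw [h.cand_of_some θ hei, hy' i x hei]
        | none =>
          rw [Bool.eq_iff_iff, h.cand_of_none θ hei]
          have hpd : d.pd i = a.1 := by rw [h.pd, ← hx]; rfl
          constructor
          · intro hy
            refine .inl ⟨a, hpd, ?_⟩
            rw [hdig]
            exact if_pos ⟨i, hx.symm, hy⟩
          · rintro (⟨a', ha, hd⟩ | ⟨a', κ, u, -, ha, -⟩ | ⟨k, hk, -⟩)
            · rw [hdig] at hd
              simp only [hG] at hd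
              split_ifs at hd with hex
              obtain ⟨i', hi', hy⟩ := hex
              have haa : a = a' := by
                have h1 := a.arity_zero
                obtain ⟨p, σ⟩ := a
                obtain ⟨p', σ'⟩ := a'
                obtain rfl : p = p' := Fin.ext (hpd.symm.trans ha)
                congr 1
                ext j
                exact (σ.1 j).elim0
              rwa [hV (hi'.trans (haa ▸ hx))] at hy
            · have h1 := a.arity_zero
              have h2 := a'.arity_pos
              have h3 : a.1 = a'.1 := Fin.ext (hpd.symm.trans ha.1)
              rw [h3] at h1
              omega
            · exact absurd hk hnw
    -- The atom over `c` is sent to its copy over `π c`, which is listed with the same evidence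
    -- because the keys agree. Unless observed, it has the value read off from the interval that
    -- contains `c`.
    · obtain ⟨i', hi', hei'⟩ := h.exists_of_keyOf_eq hx.symm (hπ c)
      refine ⟨i', ?_, ?_⟩
      · rw [hi', ← hx]
        simp only [place]
        congr 1
        funext j
        simp [spread]
      · cases hei : e i with
        | some x => rw [h.cand_of_some θ hei, hy' i' x (hei'.trans hei)]
        | none =>
          rw [Bool.eq_iff_iff, h.cand_of_none θ hei]
          have hat := (h.isAt_unary_iff i c a).2 hx.symm
          have harg : d.arg 0 i = c := hat.2 ⟨0, a.arity_pos⟩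
          have hga : g (π c) a = true ↔ y' i' = true := by
            simp only [hg, decide_eq_true_iff]
            constructor
            · rintro ⟨k, hk, hy⟩
              rwa [hV (hk.trans hi'.symm)] at hy
            · exact fun hy => ⟨i', hi', hy⟩
          rw [← hga]
          constructor
          · intro hy
            have hcc := (hint c (g (π c))).2 rfl
            refine .inr (.inl ⟨a, keyOf b d c, g (π c), hy, ?_, ?_, ?_, ?_⟩)
            · rwa [harg]
            · rw [harg]
            · rw [harg, hdig]
              exact hcc.1
            · rw [harg, hdig]
              exact hcc.2
          · rintro (⟨a', ha, hd⟩ | ⟨a', κ, u, hu, ha, rfl, h1, h2⟩ | ⟨k, hk, -⟩)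
            · have h1 := a'.arity_zero
              have h2 := a.arity_pos
              have h3 : a'.1 = a.1 := Fin.ext (ha.symm.trans hat.1)
              rw [h3] at h1
              omega
            · have haa : a' = a := SAtom.ext_one (Fin.ext (ha.1.symm.trans hat.1))
              rw [harg, hdig] at h1 h2
              rw [(hint c u).1 ⟨h1, h2⟩, ← haa]
              exact hu
            · exact absurd hk hnw
    · exact absurd (hx ▸ one_lt_width_place cd a) hw

theorem Encodes.isMPE_bestCand (h : Encodes d w V e) (hV : Function.Injective V)
    (hb : (Finset.univ.filter fun i => 1 < (V i).width).card ≤ b) (F : Fin m → Formula ar)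
    (hF : ∀ i, (F i).vars.card ≤ 2) :
    IsMPE F w V e (fun i => decide (cand ar b d (bestCand b F d) i = 1)) := by
  refine ⟨fun i x hx => h.cand_of_some _ hx, fun y' hy' => ?_⟩
  obtain ⟨θ, hθ, hle⟩ := h.exists_cand hV hb F hy'
  refine hle.trans ?_
  rw [← (h.candData θ).liftedProb_eq hV hb F hF, ← (h.candData _).liftedProb_eq hV hb F hF]
  exact bestCand_spec b F d θ hθ

/-- MPE inference is domain-lifted. -/
theorem exists_mpe_program (F : Fin m → Formula ar) (hF : ∀ i, (F i).vars.card ≤ 2) (b : ℕ) :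
    ∃ (P : Program) (p : Polynomial ℕ), ∀ x : Problem m ar b,
      ∃ (N : ℕ) (s : State), Runs P (inputState x.w x.V x.e) N s ∧ N ≤ p.eval x.n ∧
        ∃ y : Fin x.q → Bool, (∀ i : Fin x.q, s.nat 3 i = (y i).toNat) ∧ IsMPE F x.w x.V x.e y := by
  set C := Problem.ctx m ar b with hC
  set y : Problem m ar b → ℕ → ℕ := fun x i => cand ar b x.data (bestCand b F x.data) i with hy
  have hd : DataComp C m (fun x => x.data) := Problem.dataComp
  set L := C.level with hL
  -- The output array `3` lies below the level of `C`, so `Does.forLoop` does not apply, and the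
  -- loop is built directly with counter at `L` and bound at `L + 1`.
  set inv : Problem m ar b → ℕ → State → Prop := fun x i s => C.rep x s ∧
    (∀ j < i, s.nat 3 j = y x j) ∧ s.nat L 0 = i ∧ s.nat (L + 1) 0 = x.q with hinv
  have hL3 : 3 < L := by simp only [hL, hC, Problem.ctx]; omega
  have hrep3 : ∀ x s i v, C.rep x s → C.rep x (s.updNat 3 i v) := fun x s i v hs =>
    ⟨fun k hk h3 => by
      rw [← hs.1 k hk h3]
      funext j
      rw [State.updNat_nat, if_neg (fun h => h3 h.1)], hs.2⟩
  let E : Ctx (Problem m ar b × ℕ) :=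
    { rep := fun z s => inv z.1 z.2 s ∧ z.2 < z.1.q
      size := fun z => z.1.n
      level := L + 2
      stable := fun z => (((C.stable z.1).mono (by omega)).and (Stable.and
        (Q := fun s => ∀ j < z.2, s.nat 3 j = y z.1 j)
        (fun s s' hs hj j hji => (congrFun (hs 3 (by omega)).1 j).trans (hj j hji))
        ((Stable.nat_eq (by omega) _ _).and (.nat_eq (by omega) _ _)))).and (.const _ _) }
  have hE : Ext E C Prod.fst := ⟨fun _ _ hs => hs.1.1, fun _ => rfl, Nat.le_add_right L 2⟩
  have hcount : NComp E Prod.snd := by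
    obtain ⟨p, hp⟩ := hd.q.1
    refine ⟨⟨p, fun z s hs => hs.2.le.trans (hp z.1 s hs.1.1)⟩, fun L' hL' =>
      .setNat le_rfl (.const 0) (.get L (.const 0)) fun z s hs => ?_⟩
    simp [State.updNat_nat, NatExp.eval, hs.1.2.2.1]
  -- The best candidate is recomputed for every output cell, at the price of a polynomial factor.
  have hval : NComp E (fun z => y z.1 z.2) := (hd.ext hE).cand ((hd.bestCand F).ext hE) hcount
  have hbody : Does (fun (z : Problem m ar b × ℕ) s => inv z.1 z.2 s ∧ z.2 < z.1.q)
      (fun z => z.1.n) 0 (fun z s => inv z.1 (z.2 + 1) s) := by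
    refine Does.seq (mid := fun z s => E.rep z s ∧ s.nat (L + 2) 0 = y z.1 z.2)
      ((hval.run_self (L := L + 2) le_rfl).conseq (Nat.zero_le _) (fun _ _ h => h)
        (fun _ _ _ _ _ h => h)) ?_
    refine Does.seq (mid := fun z s => C.rep z.1 s ∧ (∀ j < z.2 + 1, s.nat 3 j = y z.1 j) ∧
      s.nat L 0 = z.2 ∧ s.nat (L + 1) 0 = z.1.q)
      (.setNat (Nat.zero_le 3) (.get L (.const 0)) (.get (L + 2) (.const 0)) ?_)
      (.setNat (Nat.zero_le L) (.const 0) (.add (.get L (.const 0)) (.const 1)) ?_)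
    · rintro z s ⟨⟨⟨h1, h2, h3, h4⟩, -⟩, h5⟩
      simp only [NatExp.eval, h3, h5]
      refine ⟨hrep3 _ _ _ _ h1, fun j hj => ?_, ?_, ?_⟩
      · rw [State.updNat_nat]
        split_ifs with hjz
        · rw [hjz.2]
        · exact h2 j (by omega)
      · rwa [State.updNat_nat, if_neg (by omega)]
      · rwa [State.updNat_nat, if_neg (by omega)]
    · rintro z s ⟨h1, h2, h3, h4⟩
      simp only [NatExp.eval, h3]
      refine ⟨C.stable _ _ _ (agreeBelow_updNat le_rfl s 0 (z.2 + 1)) h1, fun j hj => ?_, ?_, ?_⟩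
      · rw [State.updNat_nat, if_neg (by omega)]
        exact h2 j hj
      · simp [State.updNat_nat]
      · rwa [State.updNat_nat, if_neg (by omega)]
  have hloop := Does.whileLt (I := L) (J := L + 1) (inv := inv) (b := fun x => x.q)
    (sz := fun x => x.n) (L := 0) (fun x i s hs => hs.2.2)
    (by
      obtain ⟨p, hp⟩ := hd.q.1
      exact ⟨p, fun x s hs => hp x s hs.1⟩) hbody
  have hinit : Does C.rep (fun x => x.n) 0 (fun x s => inv x 0 s) := by
    refine Does.seq (mid := fun x s => C.rep x s ∧ s.nat (L + 1) 0 = x.q)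
      ((hd.q.run (L := L + 1) (by omega) (fun _ _ h => h) (fun x => (C.stable x).mono
        (by omega))).conseq (Nat.zero_le _) (fun _ _ h => h) (fun _ _ _ _ _ h => h))
      (.setNat (Nat.zero_le L) (.const 0) (.const 0) ?_)
    rintro x s ⟨h1, h2⟩
    refine ⟨C.stable _ _ _ (agreeBelow_updNat le_rfl s _ _) h1, fun j hj => by omega, ?_, ?_⟩
    · simp [State.updNat_nat, NatExp.eval]
    · rwa [State.updNat_nat, if_neg (by omega)]
  obtain ⟨P, p, hP⟩ := hinit.seq hloop
  refine ⟨P, p, fun x => ?_⟩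
  obtain ⟨N, s, h1, h2, -, h3⟩ := hP x x.input x.ctx_rep_input
  refine ⟨N, s, h1, h2, fun i => decide (y x i = 1), fun i => ?_,
    x.encodes.isMPE_bestCand x.inj x.wide F hF⟩
  rw [h3.2.1 i i.2]
  have hc := x.encodes.cand_eq (b := b) (bestCand b F x.data) i
  refine hc.trans ?_
  simp only [hy]
  cases decide (cand ar b x.data (bestCand b F x.data) i = 1) <;> simp [encodeEvidence]

end

end MarkovLogic

theorem mainTheorem5 {r m : ℕ} (ar : Fin r → ℕ) (F : Fin m → MarkovLogic.Formula ar)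
    (hF : ∀ i, (F i).vars.card ≤ 2) (b : ℕ) :
    (∃ (P : MarkovLogic.Program) (p : Polynomial ℕ),
      ∀ (w : Fin m → ℝ) (n q : ℕ) (V : Fin q → MarkovLogic.GroundAtom ar n)
        (e : Fin q → Option Bool), Function.Injective V →
        (Finset.univ.filter fun i => 1 < MarkovLogic.Atom.width (V i)).card ≤ b →
        ∃ (N : ℕ) (s : MarkovLogic.State),
          MarkovLogic.Runs P (MarkovLogic.inputState w V e) N s ∧
          N ≤ p.eval n ∧
          s.real 1 0 = MarkovLogic.prob F w V e) ∧
    (∃ (P : MarkovLogic.Program) (p : Polynomial ℕ),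
      ∀ (w : Fin m → ℝ) (n q : ℕ) (V : Fin q → MarkovLogic.GroundAtom ar n)
        (e : Fin q → Option Bool), Function.Injective V →
        (Finset.univ.filter fun i => 1 < MarkovLogic.Atom.width (V i)).card ≤ b →
        ∃ (N : ℕ) (s : MarkovLogic.State),
          MarkovLogic.Runs P (MarkovLogic.inputState w V e) N s ∧
          N ≤ p.eval n ∧
          ∃ y : Fin q → Bool, (∀ i : Fin q, s.nat 3 i = (y i).toNat) ∧
            MarkovLogic.IsMPE F w V e y) := by
  obtain ⟨P, p, hP⟩ := MarkovLogic.exists_marginal_program F hF b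
  obtain ⟨Q, t, hQ⟩ := MarkovLogic.exists_mpe_program F hF b
  exact ⟨⟨P, p, fun w n q V e hV hb => hP ⟨w, n, q, V, e, hV, hb⟩⟩,
    ⟨Q, t, fun w n q V e hV hb => hQ ⟨w, n, q, V, e, hV, hb⟩⟩⟩
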